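/- **Corollary 1.9.** Let $\Gamma$ be a subset of the unit sphere of $\mathbb R^n$ such that the punctured cone $M=\{tx \mid t>0,\ x\in\Gamma\}$ is an embedded, orientable hypersurface of class $C^2$, and let $U\subset\mathbb R^n$ be an open set with $U\cap(\overline M\setminus M)=\varnothing$ (for instance $U=\mathbb R^n\setminus\{0\}$ if $\Gamma$ is compact). If $M$ is a stable minimal hypersurface in $U$, then for every real $\alpha\ge 0$ it is also $f$-stable in $U$ for the density $f(x)=|x|^\alpha$. Here, for a density $f$ of class $C^2$ near the points of $M$, $M$ is called *$f$-stable in $U$* if (i) and (ii) hold. (i) $M$ is $f$-stationary in $U$: for every $C^2$ family $(\varphi_t)_{|t|<\varepsilon}$ of maps $\mathbb R^n\to\mathbb R^n$ with $\varphi_0=\mathrm{id}$ and $\varphi_t=\mathrm{id}$ outside of a compact set $K\subset U$ that does not depend on $t$, $$\frac{d}{dt}\Big|_{t=0}\int_{\varphi_t(M\cap K)} f\,d\mathcal H_{n-1}=0 .$$ (ii) For every $C^1$ normal vector field $X$ along $M$ that vanishes outside of a compact subset of $U$, $$\int_M f\Big[\sum_{i,j}\langle \mathbf B(e_i,e_j),X\rangle^2+\langle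 \mathbf H,X\rangle^2\Big]d\mathcal H_{n-1}\ \le\ \int_M \Big[f\sum_i\big|(D_{e_i}X)^{\perp}\big|^2+\operatorname{Hess} f(X,X)\Big]d\mathcal H_{n-1},$$ where $(e_i)$ is an orthonormal basis of the tangent space of $M$, $\mathbf B$ is the second fundamental form of $M$ in $\mathbb R^n$, $\mathbf H=\sum_i\mathbf B(e_i,e_i)$, and $\perp$ denotes the normal component. *Stable minimal* means $f$-stable with $f\equiv 1$. -/

import Mathlib

/-! Weighted area of hypersurfaces of `ℝⁿ`, its stationary and stable hypersurfaces, and cones. -/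

namespace WeightedArea

/-- Euclidean space `ℝⁿ`. -/
abbrev E (n : ℕ) : Type := EuclideanSpace ℝ (Fin n)

/-- The cone `C(Γ) = {t x | t ≥ 0, x ∈ Γ}` over a subset `Γ` of the unit sphere. -/
def cone {n : ℕ} (Γ : Set (E n)) : Set (E n) :=
  {y | ∃ t : ℝ, 0 ≤ t ∧ ∃ x ∈ Γ, y = t • x}

/-- `M` is an embedded hypersurface of class `C²` in `ℝⁿ` (without boundary, not necessarily
closed as a subset): near each of its points it is the zero set of a `C²` function without
critical points. -/
def IsC2Hypersurface {n : ℕ} (M : Set (E n)) : Prop :=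
  ∀ p ∈ M, ∃ V : Set (E n), IsOpen V ∧ p ∈ V ∧ ∃ u : E n → ℝ,
    ContDiffOn ℝ 2 u V ∧ (∀ x ∈ V, fderiv ℝ u x ≠ 0) ∧ M ∩ V = {x ∈ V | u x = 0}

/-- The tangent space `T_x M`; for a submanifold the tangent cone is already a linear space. -/
def tangentSpace {n : ℕ} (M : Set (E n)) (x : E n) : Submodule ℝ (E n) :=
  Submodule.span ℝ (tangentConeAt ℝ M x)

/-- The orthogonal projection of `ℝⁿ` onto `T_x M`. -/
noncomputable def tangentProj {n : ℕ} (M : Set (E n)) (x : E n) : E n →L[ℝ] E n :=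
  (tangentSpace M x).starProjection

/-- The orthogonal projection of `ℝⁿ` onto the normal space of `M` at `x`. -/
noncomputable def normalProj {n : ℕ} (M : Set (E n)) (x : E n) : E n →L[ℝ] E n :=
  (tangentSpace M x)ᗮ.starProjection

/-- The derivative `D_v F` at `x ∈ M`, in a direction `v ∈ T_x M`, of a map `F` given on `M`.
A derivative of `F` within `M` is determined by `F` on the tangent vectors of `M`, and it is used
on tangent vectors only. -/
noncomputable def tangentialDeriv {n : ℕ} (M : Set (E n)) (F : E n → E n) (x v : E n) : E n :=
  fderivWithin ℝ F M x v

/-- The second fundamental form `B(v, w) = (D_v W)^⊥` for `v, w ∈ T_x M`, where `W` is a tangent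
field with `W(x) = w`; we take `W(y)` to be the tangential part of `w` at `y`. -/
noncomputable def secondFundamentalForm {n : ℕ} (M : Set (E n)) (x v w : E n) : E n :=
  normalProj M x (tangentialDeriv M (fun y => tangentProj M y w) x v)

/-- An orthonormal basis `e_1, …, e_k` of `T_x M`, with `k = dim T_x M`. -/
noncomputable def frame {n : ℕ} (M : Set (E n)) (x : E n)
    (i : Fin (Module.finrank ℝ (tangentSpace M x))) : E n :=
  (stdOrthonormalBasis ℝ (tangentSpace M x) i : E n)

/-- The mean curvature vector `H = ∑ i, B(e_i, e_i)`. -/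
noncomputable def meanCurvature {n : ℕ} (M : Set (E n)) (x : E n) : E n :=
  ∑ i, secondFundamentalForm M x (frame M x i) (frame M x i)

/-- The Hessian `Hess f (v, w)` in `ℝⁿ`. -/
noncomputable def hess {n : ℕ} (f : E n → ℝ) (x v w : E n) : ℝ :=
  fderiv ℝ (fderiv ℝ f) x v w

/-- The `f`-weighted area `∫_S f dℋ_{n-1}`. -/
noncomputable def weightedArea {n : ℕ} (f : E n → ℝ) (S : Set (E n)) : ℝ :=
  ∫ x in S, f x ∂(MeasureTheory.Measure.hausdorffMeasure ((n : ℝ) - 1))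

/-- `φ_t`, `-ε < t < ε`, is a `C²` family of maps with `φ_0 = id`, all of which are the identity
outside of the compact subset `K` of `U`. -/
structure IsDeformation {n : ℕ} (U K : Set (E n)) (ε : ℝ) (φ : ℝ → E n → E n) : Prop where
  pos : 0 < ε
  isCompact : IsCompact K
  subset : K ⊆ U
  contDiffOn : ContDiffOn ℝ 2 (fun p : ℝ × E n => φ p.1 p.2) (Set.Ioo (-ε) ε ×ˢ Set.univ)
  zero : ∀ x, φ 0 x = x
  eq_self : ∀ t ∈ Set.Ioo (-ε) ε, ∀ x, x ∉ K → φ t x = x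

/-- `M` is `f`-stationary in `U`: the first variation of the `f`-weighted area vanishes for every
compactly supported deformation in `U`. The area is that of the part `M ∩ K` of `M`, as the rest
of `M` is not moved (and may have infinite weighted area). -/
def IsStationary {n : ℕ} (f : E n → ℝ) (M U : Set (E n)) : Prop :=
  ∀ (K : Set (E n)) (ε : ℝ) (φ : ℝ → E n → E n), IsDeformation U K ε φ →
    HasDerivAt (fun t => weightedArea f (φ t '' (M ∩ K))) 0 0

/-- `X` is a normal vector field of class `C¹` along `M` with compact support in `U`. -/
structure IsNormalVariation {n : ℕ} (M U : Set (E n)) (X : E n → E n) : Prop where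
  contDiffOn : ContDiffOn ℝ 1 X M
  normal : ∀ x ∈ M, X x ∈ (tangentSpace M x)ᗮ
  compactSupport : ∃ K : Set (E n), IsCompact K ∧ K ⊆ U ∧ ∀ x ∈ M, x ∉ K → X x = 0

/-- `M` is `f`-stable in `U`: it is `f`-stationary in `U` and, for all normal variation fields `X`
with compact support in `U`,
`∫_M f (∑ ⟨B(e_i, e_j), X⟩² + ⟨H, X⟩²) ≤ ∫_M f ∑ |(D_{e_i} X)^⊥|² + Hess f (X, X)`.
For `f = 1` these are the stable minimal hypersurfaces. -/
structure IsStable {n : ℕ} (f : E n → ℝ) (M U : Set (E n)) : Prop where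
  stationary : IsStationary f M U
  secondVariation : ∀ X : E n → E n, IsNormalVariation M U X →
    ∫ x in M, f x * ((∑ i, ∑ j,
          (inner ℝ (secondFundamentalForm M x (frame M x i) (frame M x j)) (X x)) ^ 2)
        + (inner ℝ (meanCurvature M x) (X x)) ^ 2)
        ∂(MeasureTheory.Measure.hausdorffMeasure ((n : ℝ) - 1))
      ≤ ∫ x in M, (f x * (∑ i, ‖normalProj M x (tangentialDeriv M X x (frame M x i))‖ ^ 2)
        + hess f x (X x) (X x))
        ∂(MeasureTheory.Measure.hausdorffMeasure ((n : ℝ) - 1))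

/-- `M` is orientable: it has a continuous unit normal field. -/
def IsOrientable {n : ℕ} (M : Set (E n)) : Prop :=
  ∃ ν : E n → E n, ContinuousOn ν M ∧
    ∀ x ∈ M, ‖ν x‖ = 1 ∧ ν x ∈ (tangentSpace M x)ᗮ

end WeightedArea

/-! The rays of the cone are tangent to $M$, so the gradient of $f=|x|^\alpha$ is tangent to $M$ as
well. If $M$ is nonempty, the origin lies in $\overline M\setminus M$, hence not in $U$, and $f$ is
smooth on $U$.

Stationarity. Let a deformation $\varphi$ have velocity $V$. Then $x\mapsto\varphi_{tf(x)}(x)$ has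
velocity $fV$, and the unweighted first variation along it is $\int \mathrm{div}_M(fV)=\int
f\,\mathrm{div}_M V+df(V^\top)$. Since $df$ kills normal vectors, $df(V^\top)=df(V)$, and this is
the $f$-weighted first variation along $V$ (`IsStationary.of_gradient_tangent`). What it needs is
the first variation formula for arbitrary deformations, `IsC2Hypersurface.hasDerivAt_weightedArea`.
That is the area formula `IsC2Hypersurface.setIntegral_image` differentiated under the integral;
neither the divergence theorem nor the mean curvature enters.

Second variation. Test the unweighted inequality with $Y=|x|^{\alpha/2}X$. The curvature side
becomes the weighted one. With $g=|x|^{\alpha-2}|X|^2$ the gradient term becomes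
$|x|^\alpha\sum_i|(D_{e_i}X)^\perp|^2+\alpha|x|^{\alpha-2}\langle D_xX,X\rangle+\frac{\alpha^2}4 g$,
whose cross term involves only the radial derivative (`sum_norm_normalProj_rpow_smul`). The scaling
of the area on a cone gives $\int D_xg=-(n-1)\int g$ (`IsC2Hypersurface.integral_radial_deriv`),
which turns the cross term into a multiple of $\int g$. As $X\perp x$, $\mathrm{Hess}f(X,X)=\alpha
g$. The desired right-hand side exceeds the one obtained by
$(\frac{\alpha^2}4+\frac{\alpha(n-1)}2)\int g\ge0$. -/

namespace WeightedArea

open Set Filter Topology MeasureTheory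
open scoped NNReal ENNReal

/-! ### Tangent spaces and projections of a $C^2$ hypersurface -/

section Tangent

variable {n : ℕ} {M : Set (E n)}

/-- Derivatives of a map along `M` agree on the tangent space. -/
theorem eqOn_tangentSpace {F : Type*} [NormedAddCommGroup F] [NormedSpace ℝ F] {f : E n → F}
    {f₁ f₂ : E n →L[ℝ] F} {x : E n} (h₁ : HasFDerivWithinAt f f₁ M x)
    (h₂ : HasFDerivWithinAt f f₂ M x) : EqOn f₁ f₂ (tangentSpace M x) := by
  intro v hv
  have : tangentSpace M x ≤ LinearMap.eqLocus (f₁ : E n →ₗ[ℝ] F) (f₂ : E n →ₗ[ℝ] F) :=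
    Submodule.span_le.2 fun w hw => h₁.unique_on h₂ hw
  exact this hv

/-- `fderivWithin` is an arbitrary choice off the tangent space; on tangent vectors any derivative
within $M$ computes it. -/
theorem tangentialDeriv_eq {F : E n → E n} {F' : E n →L[ℝ] E n} {x v : E n}
    (h : HasFDerivWithinAt F F' M x) (hv : v ∈ tangentSpace M x) :
    tangentialDeriv M F x v = F' v :=
  eqOn_tangentSpace h.differentiableWithinAt.hasFDerivWithinAt h hv

/-- The velocity of a differentiable curve on `M` is tangent to `M`. -/
theorem mem_tangentSpace_of_hasDerivAt {γ : ℝ → E n} {v : E n} (hγ : HasDerivAt γ v 0)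
    (hM : ∀ᶠ t in 𝓝 0, γ t ∈ M) : v ∈ tangentSpace M (γ 0) := by
  refine Submodule.subset_span
    (mem_tangentConeAt_of_seq (𝓝[≠] (0 : ℝ)) (fun t => t⁻¹) (fun t => γ t - γ 0) ?_ ?_ ?_)
  · have := (hγ.continuousAt.sub (continuousAt_const (y := γ 0))).tendsto
    simp only [Pi.sub_apply, sub_self] at this
    exact this.mono_left nhdsWithin_le_nhds
  · filter_upwards [hM.filter_mono nhdsWithin_le_nhds] with t ht
    simpa using ht
  · have := hasDerivAt_iff_tendsto_slope.1 hγ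
    simpa [slope_fun_def] using this

/-- The tangent space of a regular level set is the kernel of the differential. -/
theorem tangentSpace_eq_ker {V : Set (E n)} (hV : IsOpen V) {u : E n → ℝ}
    (hu : ContDiffOn ℝ 2 u V) (hu' : ∀ x ∈ V, fderiv ℝ u x ≠ 0)
    (hMV : M ∩ V = {x ∈ V | u x = 0}) {x : E n} (hx : x ∈ M) (hxV : x ∈ V) :
    tangentSpace M x = LinearMap.ker (fderiv ℝ u x : E n →ₗ[ℝ] ℝ) := by
  have hs : HasStrictFDerivAt u (fderiv ℝ u x) x :=
    (hu.contDiffAt (hV.mem_nhds hxV)).hasStrictFDerivAt two_ne_zero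
  have hux : u x = 0 := (hMV.subset ⟨hx, hxV⟩).2
  apply le_antisymm
  · intro v hv
    have h0 : HasFDerivWithinAt u (0 : E n →L[ℝ] ℝ) M x := by
      refine (hasFDerivWithinAt_const (0 : ℝ) x M).congr_of_eventuallyEq ?_ hux
      filter_upwards [self_mem_nhdsWithin, mem_nhdsWithin_of_mem_nhds (hV.mem_nhds hxV)]
        with y hy hyV
      exact (hMV.subset ⟨hy, hyV⟩).2
    exact eqOn_tangentSpace hs.hasFDerivAt.hasFDerivWithinAt h0 hv
  · intro v hv
    have hr : ((fderiv ℝ u x : E n →L[ℝ] ℝ) : E n →ₗ[ℝ] ℝ).range = ⊤ := by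
      apply LinearMap.range_eq_top.2
      apply LinearMap.surjective
      intro h
      exact hu' x hxV (ContinuousLinearMap.coe_injective h)
    -- The implicit function parametrizes the level set over the kernel, so $t\mapsto g(tv)$ is a
    -- curve in $M$ through $x$ with velocity $v$.
    set g := HasStrictFDerivAt.implicitFunction u (fderiv ℝ u x) hs hr (u x) with hg
    have hgd := hs.to_implicitFunction hr
    have hgx : g 0 = x := by simp [hg]
    let w : LinearMap.ker ((fderiv ℝ u x : E n →L[ℝ] ℝ) : E n →ₗ[ℝ] ℝ) := ⟨v, hv⟩
    have hline : HasDerivAt (fun t : ℝ => t • w) w 0 := by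
      simpa using (hasDerivAt_id (0 : ℝ)).smul_const w
    have hγ : HasDerivAt (fun t : ℝ => g (t • w)) v 0 := by
      have h1 : HasFDerivAt g
          (LinearMap.ker ((fderiv ℝ u x : E n →L[ℝ] ℝ) : E n →ₗ[ℝ] ℝ)).subtypeL
          ((fun t : ℝ => t • w) 0) := by
        simpa using hgd.hasFDerivAt
      exact h1.comp_hasDerivAt 0 hline
    have hcont : Tendsto (fun t : ℝ => t • w) (𝓝 0) (𝓝 0) := by
      simpa using hline.continuousAt.tendsto
    have hlev : ∀ᶠ t : ℝ in 𝓝 0, u (g (t • w)) = u x := by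
      have h := hs.map_implicitFunction_eq hr
      have h2 : Tendsto (fun t : ℝ => (u x, t • w)) (𝓝 0) (𝓝 (u x, 0)) :=
        tendsto_const_nhds.prodMk_nhds hcont
      exact h2.eventually h
    have hVt : ∀ᶠ t : ℝ in 𝓝 0, g (t • w) ∈ V := by
      have h := hγ.continuousAt.tendsto
      simp only [zero_smul, hgx] at h
      exact h.eventually (hV.mem_nhds hxV)
    have := mem_tangentSpace_of_hasDerivAt (M := M) hγ (by
      filter_upwards [hlev, hVt] with t h1 h2
      exact (hMV.symm.subset ⟨h2, h1.trans hux⟩).1)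
    simpa [hgx] using this

/-- Local description of a hypersurface by a normal field of class `C⁰`, with the estimate that
chords are nearly tangential. -/
theorem IsC2Hypersurface.exists_normal (hM : IsC2Hypersurface M) {p : E n} (hp : p ∈ M) :
    ∃ V : Set (E n), IsOpen V ∧ p ∈ V ∧ ∃ w : E n → E n, ContinuousOn w V ∧ (∀ x ∈ V, w x ≠ 0) ∧
      (∀ x ∈ M ∩ V, tangentSpace M x = (ℝ ∙ w x)ᗮ) ∧ (∃ C : Set (E n), IsClosed C ∧
        M ∩ V = V ∩ C) ∧
      ∀ c > 0, ∀ᶠ q : E n × E n in 𝓝 (p, p), q.1 ∈ M → q.2 ∈ M →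
        |inner ℝ (w p) (q.1 - q.2)| ≤ c * ‖q.1 - q.2‖ := by
  obtain ⟨V, hV, hpV, u, hu, hu', hMV⟩ := hM p hp
  refine ⟨V, hV, hpV, fun x => (InnerProductSpace.toDual ℝ (E n)).symm (fderiv ℝ u x), ?_, ?_, ?_,
    ?_, ?_⟩
  · exact (InnerProductSpace.toDual ℝ (E n)).symm.continuous.comp_continuousOn
      (hu.continuousOn_fderiv_of_isOpen hV (by norm_num))
  · intro x hx h
    exact hu' x hx (by simpa using h)
  · rintro x ⟨hx, hxV⟩
    rw [tangentSpace_eq_ker hV hu hu' hMV hx hxV]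
    ext v
    rw [Submodule.mem_orthogonal_singleton_iff_inner_right, InnerProductSpace.toDual_symm_apply]
    rfl
  · obtain ⟨C, hC, h⟩ := continuousOn_iff_isClosed.1 hu.continuousOn {0} isClosed_singleton
    exact ⟨C, hC, by rw [hMV, inter_comm V C, ← h, inter_comm]; rfl⟩
  · intro c hc
    have hs : HasStrictFDerivAt u (fderiv ℝ u p) p :=
      (hu.contDiffAt (hV.mem_nhds hpV)).hasStrictFDerivAt two_ne_zero
    have hVV : ∀ᶠ q : E n × E n in 𝓝 (p, p), q.1 ∈ V ∧ q.2 ∈ V :=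
      (hV.prod hV).mem_nhds (⟨hpV, hpV⟩ : (p, p) ∈ V ×ˢ V)
    -- Both endpoints of the chord are zeros of $u$, so strict differentiability bounds $du_p$ of
    -- the chord alone.
    filter_upwards [hs.isLittleO.def hc, hVV] with q hq hqV h1 h2
    rw [(hMV.subset ⟨h1, hqV.1⟩).2, (hMV.subset ⟨h2, hqV.2⟩).2] at hq
    rw [InnerProductSpace.toDual_symm_apply]
    simpa [abs_sub_comm] using hq

theorem normalProj_of_eq {x w : E n} (h : tangentSpace M x = (ℝ ∙ w)ᗮ) (v : E n) :
    normalProj M x v = (inner ℝ w v / ‖w‖ ^ 2) • w := by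
  have : (tangentSpace M x)ᗮ = ℝ ∙ w := by rw [h, Submodule.orthogonal_orthogonal]
  unfold normalProj
  simp only [this]
  exact Submodule.starProjection_singleton ℝ v

theorem tangentProj_eq (x : E n) : tangentProj M x = 1 - normalProj M x := by
  rw [normalProj, Submodule.starProjection_orthogonal', tangentProj, sub_sub_cancel]

theorem IsC2Hypersurface.continuousOn_normalProj (hM : IsC2Hypersurface M) :
    ContinuousOn (normalProj M) M := by
  rw [continuousOn_clm_apply]
  intro v p hp
  obtain ⟨V, hV, hpV, w, hw, hw0, hT, -, -⟩ := hM.exists_normal hp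
  have hc : ContinuousAt (fun x => (inner ℝ (w x) v / ‖w x‖ ^ 2) • w x) p := by
    have hwp : ContinuousAt w p := hw.continuousAt (hV.mem_nhds hpV)
    have : ‖w p‖ ^ 2 ≠ 0 := by simpa using hw0 p hpV
    exact ((hwp.inner continuousAt_const).div (hwp.norm.pow 2) this).smul hwp
  refine hc.continuousWithinAt.congr_of_eventuallyEq ?_ (normalProj_of_eq (hT p ⟨hp, hpV⟩) v)
  filter_upwards [self_mem_nhdsWithin, mem_nhdsWithin_of_mem_nhds (hV.mem_nhds hpV)] with y hy hyV
  exact normalProj_of_eq (hT y ⟨hy, hyV⟩) v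

theorem IsC2Hypersurface.continuousOn_tangentProj (hM : IsC2Hypersurface M) :
    ContinuousOn (tangentProj M) M :=
  (continuousOn_const.sub hM.continuousOn_normalProj).congr fun x _ => tangentProj_eq x

/-- This matches the exponent $n-1$ of the Hausdorff measure with the dimension in which linear maps
scale it. -/
theorem IsC2Hypersurface.finrank_tangentSpace (hM : IsC2Hypersurface M) {x : E n} (hx : x ∈ M) :
    Module.finrank ℝ (tangentSpace M x) + 1 = n := by
  obtain ⟨V, hV, hpV, w, hw, hw0, hT, -, -⟩ := hM.exists_normal hx
  have := Submodule.finrank_add_finrank_orthogonal (ℝ ∙ w x)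
  rw [finrank_span_singleton (hw0 x hpV), ← hT x ⟨hx, hpV⟩, finrank_euclideanSpace_fin] at this
  omega

theorem IsC2Hypersurface.cast_finrank_tangentSpace (hM : IsC2Hypersurface M) {x : E n}
    (hx : x ∈ M) : (Module.finrank ℝ (tangentSpace M x) : ℝ) = (n : ℝ) - 1 := by
  have := hM.finrank_tangentSpace hx
  rw [eq_sub_iff_add_eq]
  exact_mod_cast this

/-- Chords of a hypersurface near one of its points are nearly tangential. -/
theorem IsC2Hypersurface.eventually_chord (hM : IsC2Hypersurface M) {p : E n} (hp : p ∈ M)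
    {c : ℝ} (hc : 0 < c) : ∃ W, IsOpen W ∧ p ∈ W ∧ ∀ x ∈ M ∩ W, ∀ y ∈ M ∩ W,
      ‖normalProj M p (x - y)‖ ≤ c * ‖x - y‖ := by
  obtain ⟨V, hV, hpV, w, hw, hw0, hT, -, hch⟩ := hM.exists_normal hp
  have hwp : 0 < ‖w p‖ := norm_pos_iff.2 (hw0 p hpV)
  have h := hch (c * ‖w p‖) (by positivity)
  rw [nhds_prod_eq] at h
  obtain ⟨t, ht, h⟩ := Filter.eventually_prod_self_iff'.1 h
  obtain ⟨W, hWt, hW, hpW⟩ := mem_nhds_iff.1 ht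
  refine ⟨W, hW, hpW, fun x hx y hy => ?_⟩
  have := h x (hWt hx.2) y (hWt hy.2) hx.1 hy.1
  rw [normalProj_of_eq (hT p ⟨hp, hpV⟩), norm_smul, Real.norm_eq_abs, abs_div,
    abs_of_nonneg (by positivity : 0 ≤ ‖w p‖ ^ 2), div_mul_eq_mul_div, div_le_iff₀ (by positivity)]
  calc _ ≤ c * ‖w p‖ * ‖x - y‖ * ‖w p‖ := by gcongr
    _ = _ := by ring

/-- Zero sets of continuous functions are relatively closed, so $M$ is locally closed: an open set
intersected with a closed one. -/
theorem IsC2Hypersurface.measurableSet (hM : IsC2Hypersurface M) : MeasurableSet M := by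
  have : IsLocallyClosed M := by
    refine ((isLocallyClosed_tfae M).out 0 3).2 fun x hx => ?_
    obtain ⟨V, hV, hpV, w, hw, hw0, hT, ⟨C, hC, hMC⟩, -⟩ := hM.exists_normal hx
    refine ⟨V, hpV, hV, ?_⟩
    rintro y ⟨hyV, hy⟩
    have h1 : y ∈ closure (M ∩ V) := by
      rw [inter_comm]; exact hV.inter_closure ⟨hyV, hy⟩
    have h2 : closure (M ∩ V) ⊆ C := closure_minimal (by rw [hMC]; exact inter_subset_right) hC
    exact (hMC.symm.subset ⟨hyV, h2 h1⟩).1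
  obtain ⟨O, C, hO, hC, rfl⟩ := this
  exact hO.measurableSet.inter hC.measurableSet

end Tangent

/-! ### Comparison of Hausdorff measures -/

section Hausdorff

section Hausdorff

variable {X Y Z : Type*} [MetricSpace Y] [MeasurableSpace Y] [BorelSpace Y] [MetricSpace Z]
  [MeasurableSpace Z] [BorelSpace Z]

/-- If distances of `F` are at most `C` times those of `G`, so are the Hausdorff measures of the
images, up to the power of `C`. -/
theorem hausdorffMeasure_image_le_of_dist {F : X → Y} {G : X → Z} {S : Set X} {C : ℝ≥0} {d : ℝ}
    (hd : 0 ≤ d) (h : ∀ x ∈ S, ∀ y ∈ S, dist (F x) (F y) ≤ C * dist (G x) (G y)) :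
    Measure.hausdorffMeasure d (F '' S) ≤
      (C : ℝ≥0∞) ^ d * Measure.hausdorffMeasure d (G '' S) := by
  rcases S.eq_empty_or_nonempty with rfl | ⟨s, -⟩
  · simp
  have : Nonempty X := ⟨s⟩
  -- This is $F\circ G^{-1}$ on $G(S)$. It does not depend on the chosen preimage, because by `h`
  -- equal values of $G$ force equal values of $F$.
  set K : Z → Y := fun z => F (Function.invFunOn G S z) with hK
  have hKG : ∀ x ∈ S, K (G x) = F x := by
    intro x hx
    have hm : Function.invFunOn G S (G x) ∈ S := Function.invFunOn_mem ⟨x, hx, rfl⟩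
    have he : G (Function.invFunOn G S (G x)) = G x := Function.invFunOn_eq ⟨x, hx, rfl⟩
    have := h _ hm x hx
    rw [he, dist_self, mul_zero] at this
    exact dist_le_zero.1 this
  have hL : LipschitzOnWith C K (G '' S) := by
    refine LipschitzOnWith.of_dist_le_mul ?_
    rintro _ ⟨x, hx, rfl⟩ _ ⟨y, hy, rfl⟩
    rw [hKG x hx, hKG y hy]
    exact h x hx y hy
  have := hL.hausdorffMeasure_image_le hd
  rwa [image_image, image_congr hKG] at this

end Hausdorff

/-- Two maps whose increments differ by a factor close to one have images of nearly the same
Hausdorff measure. -/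
theorem hausdorffMeasure_image_le_of_norm_sub {X Y : Type*} [NormedAddCommGroup Y]
    [MeasurableSpace Y] [BorelSpace Y] {F G : X → Y} {S : Set X} {κ : ℝ≥0} {d : ℝ}
    (hd : 0 ≤ d) (hκ : κ < 1)
    (h : ∀ x ∈ S, ∀ y ∈ S, ‖(F x - F y) - (G x - G y)‖ ≤ κ * ‖G x - G y‖) :
    Measure.hausdorffMeasure d (F '' S) ≤
        (((1 + κ) * (1 - κ)⁻¹ : ℝ≥0) : ℝ≥0∞) ^ d * Measure.hausdorffMeasure d (G '' S) ∧
      Measure.hausdorffMeasure d (G '' S) ≤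
        (((1 + κ) * (1 - κ)⁻¹ : ℝ≥0) : ℝ≥0∞) ^ d * Measure.hausdorffMeasure d (F '' S) := by
  have hκ' : (0 : ℝ) < 1 - κ := sub_pos.2 (by exact_mod_cast hκ)
  have hco : (((1 + κ) * (1 - κ)⁻¹ : ℝ≥0) : ℝ) = (1 + (κ : ℝ)) * (1 - (κ : ℝ))⁻¹ := by
    rw [NNReal.coe_mul, NNReal.coe_inv, NNReal.coe_sub hκ.le]; simp
  have h0 : (0 : ℝ) ≤ κ := κ.2
  constructor <;> refine hausdorffMeasure_image_le_of_dist hd fun x hx y hy => ?_ <;>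
    rw [hco, dist_eq_norm, dist_eq_norm, mul_assoc]
  · have h1 := norm_le_norm_add_norm_sub' (F x - F y) (G x - G y)
    have h2 := h x hx y hy
    calc ‖F x - F y‖ ≤ (1 + κ) * ‖G x - G y‖ := by linarith
      _ ≤ _ := by
        gcongr
        have : (1 : ℝ) ≤ (1 - (κ : ℝ))⁻¹ := (one_le_inv₀ hκ').2 (by linarith)
        nlinarith [norm_nonneg (G x - G y)]
  · have h1 := norm_le_norm_add_norm_sub (F x - F y) (G x - G y)
    have h2 := h x hx y hy
    have h3 : ‖G x - G y‖ ≤ (1 - (κ : ℝ))⁻¹ * ‖F x - F y‖ := by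
      rw [inv_mul_eq_div, le_div_iff₀ hκ']
      linarith
    refine h3.trans ?_
    have : 0 ≤ (1 - (κ : ℝ))⁻¹ * ‖F x - F y‖ := by positivity
    nlinarith

/-- A local comparison of measures is a global one. -/
theorem restrict_le_of_local {X : Type*} [TopologicalSpace X] [SecondCountableTopology X]
    [MeasurableSpace X] [OpensMeasurableSpace X] {μ ν : Measure X} {S : Set X}
    (hS : MeasurableSet S)
    (h : ∀ x ∈ S, ∃ W, IsOpen W ∧ x ∈ W ∧ ∀ A ⊆ S ∩ W, MeasurableSet A → μ A ≤ ν A) :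
    μ.restrict S ≤ ν.restrict S := by
  choose! W hW hxW hle using h
  -- A countable subcover, made disjoint, reduces the claim to countable additivity.
  obtain ⟨t, htS, htc, hcov⟩ := TopologicalSpace.countable_cover_nhdsWithin (f := W) (s := S)
    fun x hx => mem_nhdsWithin_of_mem_nhds ((hW x hx).mem_nhds (hxW x hx))
  rw [Measure.le_iff]
  intro A hA
  rw [Measure.restrict_apply hA, Measure.restrict_apply hA]
  rcases t.eq_empty_or_nonempty with rfl | hne
  · have : S = ∅ := by simpa using hcov
    simp [this]
  obtain ⟨g, rfl⟩ := htc.exists_eq_range hne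
  have hWg : ∀ i, MeasurableSet (W (g i)) := fun i => (hW _ (htS ⟨i, rfl⟩)).measurableSet
  have hUn : A ∩ S = ⋃ i, (A ∩ S) ∩ disjointed (fun i => W (g i)) i := by
    rw [← inter_iUnion, iUnion_disjointed, eq_comm, inter_eq_left]
    refine inter_subset_right.trans (hcov.trans ?_)
    simp
  have hd : Pairwise (Function.onFun Disjoint
      fun i => (A ∩ S) ∩ disjointed (fun i => W (g i)) i) := fun i j hij =>
    ((disjoint_disjointed (fun i => W (g i))) hij).mono inter_subset_right inter_subset_right
  have hm : ∀ i, MeasurableSet ((A ∩ S) ∩ disjointed (fun i => W (g i)) i) := fun i =>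
    (hA.inter hS).inter (.disjointed hWg i)
  rw [hUn, measure_iUnion hd hm, measure_iUnion hd hm]
  refine ENNReal.tsum_le_tsum fun i => hle (g i) (htS ⟨i, rfl⟩) _ ?_ (hm i)
  exact inter_subset_inter inter_subset_right (disjointed_subset _ _)

/-! ### The Jacobian on the tangent space -/

section Jacobian

variable {n : ℕ} {M : Set (E n)}

/-- The factor by which the linear map `A` changes areas in the tangent space `T_x M`. -/
noncomputable def tangentialJacobian (M : Set (E n)) (A : E n →L[ℝ] E n) (x : E n) : ℝ :=
  ((A ∘L (tangentSpace M x).subtypeL : tangentSpace M x →L[ℝ] E n) :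
    tangentSpace M x →ₗ[ℝ] E n).normDet

theorem tangentialJacobian_nonneg (A : E n →L[ℝ] E n) (x : E n) :
    0 ≤ tangentialJacobian M A x := LinearMap.normDet_nonneg _

theorem tangentialJacobian_pos {A : E n →L[ℝ] E n} (hA : Function.Injective A) (x : E n) :
    0 < tangentialJacobian M A x := by
  refine (tangentialJacobian_nonneg A x).lt_of_ne' ?_
  refine ((LinearMap.normDet_ne_zero_tfae _).out 0 4).2 ?_
  exact hA.comp Subtype.val_injective

/-- Sylvester's identity. It moves a determinant on the varying space $T_xM$ to one on the fixed
space $\mathbb R^n$. -/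
theorem det_one_add_comp_comm {U V : Type*} [NormedAddCommGroup U] [InnerProductSpace ℝ U]
    [FiniteDimensional ℝ U] [NormedAddCommGroup V] [InnerProductSpace ℝ V]
    [FiniteDimensional ℝ V] (f : U →ₗ[ℝ] V) (g : V →ₗ[ℝ] U) :
    LinearMap.det (1 + g ∘ₗ f) = LinearMap.det (1 + f ∘ₗ g) := by
  let b := Module.finBasis ℝ U
  let c := Module.finBasis ℝ V
  rw [← LinearMap.det_toMatrix b, ← LinearMap.det_toMatrix c, map_add, map_add,
    LinearMap.toMatrix_comp b c b, LinearMap.toMatrix_comp c b c, LinearMap.toMatrix_one,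
    LinearMap.toMatrix_one, Matrix.det_one_add_mul_comm]

/-- `A ↦ (A† A - 1) P`, with the tangential projection `P`. -/
noncomputable def metricDefect (M : Set (E n)) (A : E n →L[ℝ] E n) (x : E n) : E n →L[ℝ] E n :=
  (ContinuousLinearMap.adjoint A ∘L A - 1) ∘L tangentProj M x

/-- The squared Jacobian is the Gram determinant of $A|_{T_xM}$, that is $\det(1+P(A^\dagger
A-1)\iota)$ on $T_xM$ with the projection $P$ and inclusion $\iota$; Sylvester's identity puts it on
$\mathbb R^n$, where its dependence on $x$ and $A$ is visibly regular. -/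
theorem tangentialJacobian_eq_sqrt (A : E n →L[ℝ] E n) (x : E n) :
    tangentialJacobian M A x = √(1 + metricDefect M A x).det := by
  have h := ContinuousLinearMap.normDet_sq (A ∘L (tangentSpace M x).subtypeL)
  set T := tangentSpace M x
  have h1 : LinearMap.det ((ContinuousLinearMap.adjoint (A ∘L T.subtypeL) ∘L (A ∘L T.subtypeL) :
      T →L[ℝ] T) : T →ₗ[ℝ] T) =
      LinearMap.det (1 + (T.orthogonalProjectionOnto : E n →ₗ[ℝ] T) ∘ₗ
        ((ContinuousLinearMap.adjoint A ∘L A - 1 : E n →L[ℝ] E n) : E n →ₗ[ℝ] E n) ∘ₗ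
          T.subtype) := by
    congr 1
    ext v
    simp [ContinuousLinearMap.adjoint_comp, Submodule.adjoint_subtypeL]
  rw [det_one_add_comp_comm] at h1
  have h2 : (1 + metricDefect M A x).det = tangentialJacobian M A x ^ 2 := by
    refine Eq.trans ?_ (h1.symm.trans h.symm)
    rfl
  rw [h2, Real.sqrt_sq (tangentialJacobian_nonneg A x)]

end Jacobian

end Hausdorff

/-! ### The area formula on a hypersurface -/

section AreaFormula

variable {n : ℕ} {M : Set (E n)}

local notation "ℋ" => Measure.hausdorffMeasure ((n : ℝ) - 1)

/-- On the $(n-1)$-dimensional Euclidean space $T_pM$ a linear map scales $\mathcal H_{n-1}$ exactly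
by `normDet`, and the inclusion of $T_pM$ is isometric. -/
theorem IsC2Hypersurface.hausdorffMeasure_image_tangentProj (hM : IsC2Hypersurface M) {p : E n}
    (hp : p ∈ M) (A : E n →L[ℝ] E n) (S : Set (E n)) :
    ℋ ((fun x => A (tangentProj M p x)) '' S) =
      ENNReal.ofReal (tangentialJacobian M A p) * ℋ (tangentProj M p '' S) := by
  set T := tangentSpace M p
  have h1 := LinearMap.hausdorffMeasure_image
    ((A ∘L T.subtypeL : T →L[ℝ] E n) : T →ₗ[ℝ] E n) (T.orthogonalProjectionOnto '' S)
  have h2 := LinearMap.hausdorffMeasure_image T.subtype (T.orthogonalProjectionOnto '' S)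
  rw [LinearMap.normDet_subtype, ENNReal.ofReal_one, one_mul] at h2
  rw [← h2, hM.cast_finrank_tangentSpace hp, image_image, image_image] at h1
  exact h1

theorem IsC2Hypersurface.one_le_dim (hM : IsC2Hypersurface M) {p : E n} (hp : p ∈ M) :
    0 ≤ (n : ℝ) - 1 := by
  rw [← hM.cast_finrank_tangentSpace hp]
  positivity

theorem IsC2Hypersurface.hausdorffMeasure_image_tangentProj_lt_top (hM : IsC2Hypersurface M)
    {p : E n} (hp : p ∈ M) {S : Set (E n)} (hS : Bornology.IsBounded S) :
    ℋ (tangentProj M p '' S) < ⊤ := by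
  set T := tangentSpace M p
  have h2 := LinearMap.hausdorffMeasure_image T.subtype (T.orthogonalProjectionOnto '' S)
  rw [LinearMap.normDet_subtype, ENNReal.ofReal_one, one_mul, image_image] at h2
  have hb : Bornology.IsBounded (T.orthogonalProjectionOnto '' S) :=
    T.orthogonalProjectionOnto.lipschitz.isBounded_image hS
  have h3 := hb.measure_lt_top (μ := Measure.hausdorffMeasure (Module.finrank ℝ T : ℝ))
  rw [← h2, hM.cast_finrank_tangentSpace hp] at h3
  exact h3

/-- The constants in the comparison of Hausdorff measures tend to one. -/
theorem exists_small_distortion (d : ℝ) {c : ℝ≥0∞} (hc : 1 < c) : ∃ κ : ℝ≥0, 0 < κ ∧ κ < 1 ∧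
    (((1 + κ) * (1 - κ)⁻¹ : ℝ≥0) : ℝ≥0∞) ^ d * (((1 + κ) * (1 - κ)⁻¹ : ℝ≥0) : ℝ≥0∞) ^ d < c := by
  have h1 : ContinuousAt (fun κ : ℝ≥0 => ((1 + κ) * (1 - κ)⁻¹ : ℝ≥0)) 0 := by
    refine (continuousAt_const.add continuousAt_id).mul (ContinuousAt.inv₀ ?_ (by simp))
    exact (continuous_const.sub continuous_id).continuousAt
  have h2 : ContinuousAt (fun κ : ℝ≥0 => (((1 + κ) * (1 - κ)⁻¹ : ℝ≥0) : ℝ≥0∞) ^ d) 0 :=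
    ENNReal.continuous_rpow_const.continuousAt.comp
      (ENNReal.continuous_coe.continuousAt.comp h1)
  have h3 : Tendsto (fun κ : ℝ≥0 => (((1 + κ) * (1 - κ)⁻¹ : ℝ≥0) : ℝ≥0∞) ^ d *
      (((1 + κ) * (1 - κ)⁻¹ : ℝ≥0) : ℝ≥0∞) ^ d) (𝓝 0) (𝓝 1) := by
    have h4 := ENNReal.Tendsto.mul h2.tendsto (by simp) h2.tendsto (by simp)
    simpa using h4
  have h5 := (h3.eventually_lt_const hc).and (gt_mem_nhds (zero_lt_one' ℝ≥0))
  have h6 : ∃ᶠ κ : ℝ≥0 in 𝓝 0, 0 < κ := by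
    have : (𝓝[>] (0 : ℝ≥0)).NeBot := inferInstance
    exact (eventually_mem_nhdsWithin (a := (0 : ℝ≥0)) (s := Ioi 0)).frequently.filter_mono
      nhdsWithin_le_nhds
  obtain ⟨κ, h, h'⟩ := (h6.and_eventually h5).exists
  exact ⟨κ, h, h'.2, h'.1⟩

/-- Near a point `p` of a hypersurface, a map with a strict derivative changes areas by a factor
close to the Jacobian at `p`. -/
theorem IsC2Hypersurface.exists_image_measure_comparison (hM : IsC2Hypersurface M) {p : E n}
    (hp : p ∈ M) {φ : E n → E n} {A : E n →L[ℝ] E n} (hφ : HasStrictFDerivAt φ A p)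
    (hanti : ∀ x y, ‖x - y‖ ≤ 2 * ‖φ x - φ y‖) {c : ℝ≥0∞} (hc : 1 < c) :
    ∃ W, IsOpen W ∧ p ∈ W ∧ ∀ S ⊆ M ∩ W,
      ℋ (φ '' S) ≤ c * (ENNReal.ofReal (tangentialJacobian M A p) * ℋ S) ∧
      ENNReal.ofReal (tangentialJacobian M A p) * ℋ S ≤ c * ℋ (φ '' S) ∧
      ℋ S ≤ c * ℋ (tangentProj M p '' S) := by
  have hd := hM.one_le_dim hp
  obtain ⟨κ, hκ0, hκ1, hκc⟩ := exists_small_distortion ((n : ℝ) - 1) hc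
  -- Each comparison costs a factor $D$: one from $\varphi$ to $A\circ P$, one from $P$ to the
  -- identity. Hence the requirement $D\cdot D<c$.
  set D : ℝ≥0∞ := (((1 + κ) * (1 - κ)⁻¹ : ℝ≥0) : ℝ≥0∞) ^ ((n : ℝ) - 1)
  have hD1 : 1 ≤ D := by
    have : (1 : ℝ≥0) ≤ (1 + κ) * (1 - κ)⁻¹ :=
      one_le_mul (by simp) ((one_le_inv₀ (tsub_pos_of_lt hκ1)).2 tsub_le_self)
    have h := ENNReal.rpow_le_rpow (ENNReal.coe_le_coe.2 this) hd
    rwa [ENNReal.coe_one, ENNReal.one_rpow] at h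
  have hDc : D ≤ c := (le_mul_of_one_le_left' hD1).trans hκc.le
  have hκ0' : (0 : ℝ) < κ := by exact_mod_cast hκ0
  -- The increments of $A\circ P$ and $\varphi$ differ by at most $(1+\|A\|)\eta|x-y|$, where one
  -- $\eta$ comes from strict differentiability and $\|A\|\eta$ from the normal part of the chord.
  -- The 2 absorbs $|x-y|\le2|\varphi x-\varphi y|$.
  set η : ℝ := κ / (2 * (1 + ‖A‖)) with hη
  have hη0 : 0 < η := by positivity
  have hηκ : η ≤ κ := by
    rw [hη]
    refine div_le_self hκ0'.le ?_
    nlinarith [norm_nonneg A]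
  obtain ⟨W₁, hW₁, hpW₁, hch⟩ := hM.eventually_chord hp hη0
  have hst := hφ.isLittleO.def hη0
  rw [nhds_prod_eq] at hst
  obtain ⟨t, ht, hst⟩ := Filter.eventually_prod_self_iff'.1 hst
  obtain ⟨W₂, hWt, hW₂, hpW₂⟩ := mem_nhds_iff.1 ht
  refine ⟨W₁ ∩ W₂, hW₁.inter hW₂, ⟨hpW₁, hpW₂⟩, fun S hS => ?_⟩
  have hPsub : ∀ z, tangentProj M p z = z - normalProj M p z := by
    intro z; rw [tangentProj_eq]; rfl
  have hid := hausdorffMeasure_image_le_of_norm_sub (F := tangentProj M p) (G := id) (S := S)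
    hd hκ1 (by
      intro x hx y hy
      have := hch x ⟨(hS hx).1, (hS hx).2.1⟩ y ⟨(hS hy).1, (hS hy).2.1⟩
      rw [← map_sub, hPsub, id, id, sub_sub_cancel_left, norm_neg]
      exact this.trans (by gcongr))
  have hφS := hausdorffMeasure_image_le_of_norm_sub
    (F := fun x => A (tangentProj M p x)) (G := φ) (S := S) hd hκ1 (by
      intro x hx y hy
      have h1 := hch x ⟨(hS hx).1, (hS hx).2.1⟩ y ⟨(hS hy).1, (hS hy).2.1⟩
      have h2 := hst x (hWt (hS hx).2.2) y (hWt (hS hy).2.2)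
      have h3 : A (tangentProj M p x) - A (tangentProj M p y) - (φ x - φ y) =
          -(φ x - φ y - A (x - y)) - A (normalProj M p (x - y)) := by
        rw [← map_sub, ← map_sub, hPsub (x - y), map_sub]
        abel
      rw [h3]
      calc _ ≤ ‖φ x - φ y - A (x - y)‖ + ‖A (normalProj M p (x - y))‖ := by
            refine (norm_sub_le _ _).trans_eq ?_
            rw [norm_neg]
        _ ≤ η * ‖x - y‖ + ‖A‖ * (η * ‖x - y‖) := by
            gcongr
            exact (A.le_opNorm _).trans (by gcongr)
        _ = (1 + ‖A‖) * η * ‖x - y‖ := by ring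
        _ ≤ (1 + ‖A‖) * η * (2 * ‖φ x - φ y‖) := by gcongr; exact hanti x y
        _ = κ * ‖φ x - φ y‖ := by
            rw [hη]
            have : 1 + ‖A‖ ≠ 0 := by positivity
            field_simp)
  rw [image_id] at hid
  rw [hM.hausdorffMeasure_image_tangentProj hp] at hφS
  set J := ENNReal.ofReal (tangentialJacobian M A p)
  refine ⟨?_, ?_, ?_⟩
  · calc ℋ (φ '' S) ≤ D * (J * ℋ (tangentProj M p '' S)) := hφS.2
      _ ≤ D * (J * (D * ℋ S)) := by gcongr; exact hid.1
      _ = (D * D) * (J * ℋ S) := by ring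
      _ ≤ _ := by gcongr
  · calc J * ℋ S ≤ J * (D * ℋ (tangentProj M p '' S)) := by gcongr; exact hid.2
      _ = D * (J * ℋ (tangentProj M p '' S)) := by ring
      _ ≤ D * (D * ℋ (φ '' S)) := mul_le_mul' le_rfl hφS.1
      _ = (D * D) * ℋ (φ '' S) := by ring
      _ ≤ _ := by gcongr
  · exact hid.2.trans (by gcongr)

/-- Compact subsets of a hypersurface have finite area. -/
theorem IsC2Hypersurface.hausdorffMeasure_lt_top (hM : IsC2Hypersurface M) {S : Set (E n)}
    (hS : IsCompact S) (hSM : S ⊆ M) : ℋ S < ⊤ := by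
  refine hS.measure_lt_top_of_nhdsWithin fun p hp => ?_
  obtain ⟨W, hW, hpW, h⟩ := hM.exists_image_measure_comparison (hSM hp)
    (hasStrictFDerivAt_id p) (fun x y => by
      simp only [id]; linarith [norm_nonneg (x - y)]) ENNReal.one_lt_two
  refine ⟨S ∩ W, inter_mem self_mem_nhdsWithin (mem_nhdsWithin_of_mem_nhds (hW.mem_nhds hpW)), ?_⟩
  refine ((h (S ∩ W) (inter_subset_inter_left _ hSM)).2.2).trans_lt ?_
  exact ENNReal.mul_lt_top (by simp) (hM.hausdorffMeasure_image_tangentProj_lt_top (hSM hp)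
    (hS.isBounded.subset inter_subset_left))

theorem IsC2Hypersurface.continuousOn_tangentialJacobian (hM : IsC2Hypersurface M)
    {A : E n → E n →L[ℝ] E n} (hA : ContinuousOn A M) :
    ContinuousOn (fun x => tangentialJacobian M (A x) x) M := by
  simp only [tangentialJacobian_eq_sqrt]
  have h1 : ContinuousOn (fun x => ContinuousLinearMap.adjoint (A x)) M :=
    ContinuousLinearMap.adjoint.continuous.comp_continuousOn hA
  have h2 : ContinuousOn (fun x => 1 + metricDefect M (A x) x) M :=
    continuousOn_const.add (((h1.clm_comp hA).sub continuousOn_const).clm_comp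
      hM.continuousOn_tangentProj)
  exact (ContinuousLinearMap.continuous_det.comp_continuousOn h2).sqrt

/-- The area formula for maps of a hypersurface. -/
theorem IsC2Hypersurface.setIntegral_image (hM : IsC2Hypersurface M) {S : Set (E n)}
    (hS : IsCompact S) (hSM : S ⊆ M) {φ : E n → E n} (hφ : ContDiff ℝ 1 φ)
    (hanti : ∀ x y, ‖x - y‖ ≤ 2 * ‖φ x - φ y‖) (f : E n → ℝ) :
    ∫ x in φ '' S, f x ∂ℋ = ∫ x in S, tangentialJacobian M (fderiv ℝ φ x) x * f (φ x) ∂ℋ := by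
  have hinj : Function.Injective φ := by
    intro x y hxy
    have := hanti x y
    rw [hxy, sub_self, norm_zero, mul_zero] at this
    exact sub_eq_zero.1 (norm_le_zero_iff.1 this)
  have hemb : MeasurableEmbedding φ := hφ.continuous.measurableEmbedding hinj
  have hJ := hM.continuousOn_tangentialJacobian
    (hφ.continuous_fderiv one_ne_zero).continuousOn
  have hdinj : ∀ x, Function.Injective (fderiv ℝ φ x) := by
    intro x
    refine (injective_iff_map_eq_zero _).2 fun v hv => ?_
    have hd : HasDerivAt (fun t : ℝ => φ (x + t • v)) (fderiv ℝ φ x v) 0 := by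
      have h1 : HasDerivAt (fun t : ℝ => x + t • v) v 0 := by
        simpa using ((hasDerivAt_id (0 : ℝ)).smul_const v).const_add x
      have h2 : HasFDerivAt φ (fderiv ℝ φ x) ((fun t : ℝ => x + t • v) 0) := by
        simpa using (hφ.differentiable one_ne_zero x).hasFDerivAt
      exact h2.comp_hasDerivAt 0 h1
    rw [hv, hasDerivAt_iff_tendsto_slope] at hd
    have h3 : ∀ t : ℝ, t ≠ 0 → ‖v‖ ≤ 2 * ‖slope (fun t : ℝ => φ (x + t • v)) 0 t‖ := by
      intro t ht
      have := hanti (x + t • v) x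
      rw [add_sub_cancel_left, norm_smul] at this
      simp only [slope_def_module, sub_zero, zero_smul, add_zero, norm_smul, norm_inv]
      have ht' : 0 < ‖t‖ := norm_pos_iff.2 ht
      field_simp
      linarith
    have h4 : ‖v‖ ≤ 2 * ‖(0 : E n)‖ := by
      refine ge_of_tendsto ((hd.norm).const_mul 2) ?_
      filter_upwards [self_mem_nhdsWithin] with t ht using h3 t ht
    simpa using h4
  set j : E n → ℝ≥0∞ := fun x => ENNReal.ofReal (tangentialJacobian M (fderiv ℝ φ x) x) with hj
  have hjc : ContinuousOn j M := ENNReal.continuous_ofReal.comp_continuousOn hJ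
  have hj0 : ∀ x, j x ≠ 0 := fun x => by
    simpa [hj] using tangentialJacobian_pos (hdinj x) x
  have hcomap : ∀ A, MeasurableSet A → Measure.comap φ ℋ A = ℋ (φ '' A) := fun A hA =>
    Measure.comap_apply φ hinj (fun s hs => hemb.measurableSet_image' hs) _ hA
  -- One factor $c$ pays for replacing $\varphi$ by its linearization at $p$, the other for freezing
  -- the density $j$ at $j(p)$. Letting $c\to1$ identifies the two measures.
  have key : ∀ c : ℝ≥0, 1 < c →
      (Measure.comap φ ℋ).restrict S ≤ (((c : ℝ≥0∞) * c) • (ℋ).withDensity j).restrict S ∧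
      ((ℋ).withDensity j).restrict S ≤ (((c : ℝ≥0∞) * c) • Measure.comap φ ℋ).restrict S := by
    intro c hc
    have hc' : (1 : ℝ≥0∞) < c := by exact_mod_cast hc
    have hloc : ∀ p ∈ S, ∃ W, IsOpen W ∧ p ∈ W ∧ ∀ A ⊆ S ∩ W, MeasurableSet A →
        ℋ (φ '' A) ≤ c * (j p * ℋ A) ∧ j p * ℋ A ≤ c * ℋ (φ '' A) ∧
        j p * ℋ A ≤ c * ∫⁻ x in A, j x ∂ℋ ∧ ∫⁻ x in A, j x ∂ℋ ≤ c * (j p * ℋ A) := by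
      intro p hp
      obtain ⟨W, hW, hpW, h⟩ := hM.exists_image_measure_comparison (hSM hp)
        (hφ.contDiffAt.hasStrictFDerivAt one_ne_zero) hanti hc'
      have hlt : j p < c * j p := by
        conv_lhs => rw [← one_mul (j p)]
        exact ENNReal.mul_lt_mul_left (hj0 p) ENNReal.ofReal_ne_top hc'
      have hcj : Tendsto (fun x => c * j x) (𝓝[M] p) (𝓝 (c * j p)) :=
        ENNReal.Tendsto.const_mul (hjc p (hSM hp)) (Or.inr ENNReal.coe_ne_top)
      have hev := (hcj.eventually_const_lt hlt).and
        ((hjc p (hSM hp)).tendsto.eventually_lt_const hlt)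
      obtain ⟨W', hW', hpW', hsub⟩ := mem_nhdsWithin.1 hev
      refine ⟨W ∩ W', hW.inter hW', ⟨hpW, hpW'⟩, fun A hA hAm => ?_⟩
      have hAM : A ⊆ M ∩ W := fun x hx => ⟨hSM (hA hx).1, (hA hx).2.1⟩
      have hAW : ∀ x ∈ A, j p < c * j x ∧ j x < c * j p := fun x hx =>
        hsub ⟨(hA hx).2.2, hSM (hA hx).1⟩
      refine ⟨(h A hAM).1, (h A hAM).2.1, ?_, ?_⟩
      · rw [← lintegral_const_mul' _ _ ENNReal.coe_ne_top, ← setLIntegral_const]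
        exact setLIntegral_mono' hAm fun x hx => (hAW x hx).1.le
      · rw [← mul_assoc, ← setLIntegral_const]
        exact setLIntegral_mono' hAm fun x hx => (hAW x hx).2.le
    constructor <;> refine restrict_le_of_local hS.measurableSet fun p hp => ?_ <;>
      obtain ⟨W, hW, hpW, h⟩ := hloc p hp <;>
      refine ⟨W, hW, hpW, fun A hA hAm => ?_⟩ <;> obtain ⟨h1, h2, h3, h4⟩ := h A hA hAm <;>
      rw [Measure.smul_apply, withDensity_apply _ hAm, hcomap A hAm, smul_eq_mul, mul_assoc]
    · exact h1.trans (by gcongr)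
    · exact h4.trans (by gcongr)
  have hlim : ∀ a b : ℝ≥0∞, (∀ c : ℝ≥0, 1 < c → a ≤ (c * c : ℝ≥0∞) * b) → a ≤ b := by
    intro a b hab
    have ht : Tendsto (fun c : ℝ≥0 => (c * c : ℝ≥0∞) * b) (𝓝[>] 1) (𝓝 (((1 : ℝ≥0) * (1 : ℝ≥0) :
        ℝ≥0∞) * b)) := by
      refine ENNReal.Tendsto.mul_const ?_ (Or.inl (by simp))
      have : Continuous fun c : ℝ≥0 => ((c * c : ℝ≥0) : ℝ≥0∞) := by fun_prop
      have := (this.tendsto 1).mono_left (nhdsWithin_le_nhds (s := Ioi 1))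
      simpa only [ENNReal.coe_mul] using this
    have := ge_of_tendsto ht (by filter_upwards [self_mem_nhdsWithin] with c hc using hab c hc)
    simpa using this
  have heq : (Measure.comap φ ℋ).restrict S = ((ℋ).withDensity j).restrict S := by
    apply le_antisymm <;> refine Measure.le_iff.2 fun A hA => hlim _ _ fun c hc => ?_
    · simpa using (key c hc).1 A
    · simpa using (key c hc).2 A
  have hSφ : MeasurableSet (φ '' S) := hemb.measurableSet_image' hS.measurableSet
  calc ∫ x in φ '' S, f x ∂ℋ = ∫ x in φ '' S, f x ∂(Measure.map φ (Measure.comap φ ℋ)) := by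
        rw [hemb.map_comap, Measure.restrict_restrict hSφ,
          inter_eq_left.2 (image_subset_range φ S)]
    _ = ∫ x in S, f (φ x) ∂(Measure.comap φ ℋ) := by
        rw [hemb.setIntegral_map, preimage_image_eq _ hinj]
    _ = ∫ x, f (φ x) ∂((ℋ).restrict S).withDensity j := by
        rw [heq, restrict_withDensity hS.measurableSet]
    _ = _ := by
        rw [integral_withDensity_eq_integral_toReal_smul₀
          ((hjc.mono hSM).aemeasurable hS.measurableSet) (by simp [hj])]
        simp only [hj, ENNReal.toReal_ofReal (tangentialJacobian_nonneg _ _), smul_eq_mul]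

end AreaFormula

/-! ### Determinant expansions and differentiation under the integral -/

section Analysis

section Determinant

variable {V : Type*} [NormedAddCommGroup V] [InnerProductSpace ℝ V] [FiniteDimensional ℝ V]

theorem contDiff_det {k : WithTop ℕ∞} : ContDiff ℝ k fun L : V →L[ℝ] V => L.det := by
  let b := Module.finBasis ℝ V
  have h : (fun L : V →L[ℝ] V => L.det) = fun L : V →L[ℝ] V =>
      ∑ σ : Equiv.Perm (Fin (Module.finrank ℝ V)), (Equiv.Perm.sign σ : ℤ) •
        ∏ i, LinearMap.toMatrix b b (L : V →ₗ[ℝ] V) (σ i) i := by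
    funext L
    have h1 := Matrix.det_apply (LinearMap.toMatrix b b (L : V →ₗ[ℝ] V))
    rw [LinearMap.det_toMatrix] at h1
    exact h1
  rw [h]
  refine ContDiff.sum fun σ _ => ?_
  have hp : ContDiff ℝ k fun L : V →L[ℝ] V =>
      ∏ i, LinearMap.toMatrix b b (L : V →ₗ[ℝ] V) (σ i) i := by
    refine contDiff_prod fun i _ => ?_
    let e : (V →L[ℝ] V) →ₗ[ℝ] ℝ :=
      { toFun := fun L => LinearMap.toMatrix b b (L : V →ₗ[ℝ] V) (σ i) i
        map_add' := fun L L' => by simp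
        map_smul' := fun c L => by simp }
    exact e.toContinuousLinearMap.contDiff
  simp only [← Int.cast_smul_eq_zsmul ℝ]
  exact hp.const_smul _

theorem hasDerivAt_det_one_add_smul (N : V →L[ℝ] V) :
    HasDerivAt (fun r : ℝ => (1 + r • N).det) (LinearMap.trace ℝ V N) 0 := by
  let b := Module.finBasis ℝ V
  set m := LinearMap.toMatrix b b (N : V →ₗ[ℝ] V) with hm
  -- The quotient left after removing the constant and linear coefficients, so that the remainder is
  -- $q(r)r^2$.
  set q := (Matrix.det (1 + (Polynomial.X : Polynomial ℝ) • m.map Polynomial.C)).divX.divX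
  have h : (fun r : ℝ => (1 + r • N).det) = fun r : ℝ => 1 + m.trace * r + q.eval r * r ^ 2 := by
    funext r
    rw [← Matrix.det_one_add_smul]
    change LinearMap.det ((1 + r • N : V →L[ℝ] V) : V →ₗ[ℝ] V) = _
    rw [← LinearMap.det_toMatrix b]
    congr 1
    have : ((1 + r • N : V →L[ℝ] V) : V →ₗ[ℝ] V) = 1 + r • (N : V →ₗ[ℝ] V) := rfl
    rw [this, map_add, map_smul, LinearMap.toMatrix_one]
  rw [h, LinearMap.trace_eq_matrix_trace ℝ b]
  have h1 := ((hasDerivAt_id (0 : ℝ)).const_mul m.trace).const_add 1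
  have h2 := (q.hasDerivAt (0 : ℝ)).mul ((hasDerivAt_id (0 : ℝ)).pow 2)
  refine (h1.add h2).congr_deriv ?_
  simp [hm]

/-- The determinant is smooth and equals $1\ne0$ at the identity, so its root is differentiable
there; the derivative is read off along the lines $r\mapsto rN$. -/
theorem exists_hasFDerivAt_sqrt_det :
    ∃ h' : (V →L[ℝ] V) →L[ℝ] ℝ, HasFDerivAt (fun N : V →L[ℝ] V => √(1 + N).det) h' 0 ∧
      ∀ N : V →L[ℝ] V, h' N = LinearMap.trace ℝ V N / 2 := by
  have hc : ContDiff ℝ 1 fun N : V →L[ℝ] V => (1 + N).det :=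
    contDiff_det.comp (contDiff_const.add contDiff_id)
  have hd := (hc.differentiable one_ne_zero 0).hasFDerivAt
  have h1 : ((1 + (0 : V →L[ℝ] V)).det) = 1 := by
    rw [add_zero]; exact LinearMap.det_id
  have hs := hd.sqrt (by rw [h1]; exact one_ne_zero)
  refine ⟨_, hs, fun N => ?_⟩
  have hl : HasDerivAt (fun r : ℝ => r • N) N 0 := by
    simpa using (hasDerivAt_id (0 : ℝ)).smul_const N
  have hd' : HasFDerivAt (fun N : V →L[ℝ] V => (1 + N).det)
      (fderiv ℝ (fun N : V →L[ℝ] V => (1 + N).det) 0) ((fun r : ℝ => r • N) 0) := by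
    simpa using hd
  have hcomp : HasDerivAt (fun r : ℝ => (1 + r • N).det)
      (fderiv ℝ (fun N : V →L[ℝ] V => (1 + N).det) 0 N) 0 := by
    have := HasFDerivAt.comp_hasDerivAt (0 : ℝ) hd' hl
    exact this
  have := hcomp.unique (hasDerivAt_det_one_add_smul N)
  rw [smul_apply, this, h1, Real.sqrt_one, smul_eq_mul]
  ring

theorem hasDerivAt_sqrt_det {N : ℝ → V →L[ℝ] V} {N' : V →L[ℝ] V} (h0 : N 0 = 0)
    (hN : HasDerivAt N N' 0) :
    HasDerivAt (fun t => √(1 + N t).det) (LinearMap.trace ℝ V N' / 2) 0 := by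
  obtain ⟨h', hh, htr⟩ := exists_hasFDerivAt_sqrt_det (V := V)
  rw [← htr]
  rw [← h0] at hh
  exact hh.comp_hasDerivAt 0 hN

theorem exists_sqrt_det_bound : ∃ δ > 0, ∃ C ≥ 0, ∀ N : V →L[ℝ] V, ‖N‖ < δ →
    |√(1 + N).det - 1| ≤ C * ‖N‖ := by
  obtain ⟨h', hh, -⟩ := exists_hasFDerivAt_sqrt_det (V := V)
  obtain ⟨C, hC, hO⟩ := hh.isBigO_sub.exists_nonneg
  obtain ⟨δ, hδ, h⟩ := Metric.eventually_nhds_iff.1 hO.bound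
  refine ⟨δ, hδ, C, hC, fun N hN => ?_⟩
  have h1 : ((1 + (0 : V →L[ℝ] V)).det) = 1 := by
    rw [add_zero]; exact LinearMap.det_id
  have := h (y := N) (by simpa using hN)
  rwa [h1, Real.sqrt_one, sub_zero] at this

/-- The adjoint as a real linear map. -/
noncomputable def adjointL : (V →L[ℝ] V) →L[ℝ] (V →L[ℝ] V) :=
  LinearMap.toContinuousLinearMap
    { toFun := fun A => ContinuousLinearMap.adjoint A
      map_add' := fun A B => map_add _ A B
      map_smul' := fun c A => by simp }

@[simp]
theorem adjointL_apply (A : V →L[ℝ] V) : adjointL A = ContinuousLinearMap.adjoint A := rfl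

end Determinant

/-- A `C¹` function of `(t, x)` is Lipschitz in `t` at `t = 0`, uniformly for `x` in a compact
set. -/
theorem exists_uniform_lipschitz {X F : Type*} [NormedAddCommGroup X] [NormedSpace ℝ X]
    [NormedAddCommGroup F] [NormedSpace ℝ F] {G : ℝ × X → F} {O : Set (ℝ × X)} (hO : IsOpen O)
    (hG : ContDiffOn ℝ 1 G O) {K : Set X} (hK : IsCompact K) (hKO : ∀ x ∈ K, ((0 : ℝ), x) ∈ O) :
    ∃ δ > 0, ∃ C ≥ 0, ∀ t : ℝ, |t| < δ → ∀ x ∈ K,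
      (t, x) ∈ O ∧ ‖G (t, x) - G (0, x)‖ ≤ C * |t| := by
  have hf : ContinuousOn (fderiv ℝ G) O := hG.continuousOn_fderiv_of_isOpen hO le_rfl
  have hf0 : ContinuousOn (fun x : X => fderiv ℝ G (0, x)) K :=
    hf.comp (by fun_prop) hKO
  obtain ⟨B, hB⟩ := hK.exists_bound_of_continuousOn hf0
  set C := max B 0 + 1
  have hCpos : 0 < C := by positivity
  -- The bound $\|DG\|<C$ holds on an open set containing $\{0\}\times K$; the tube lemma gives a
  -- time interval on which it holds for all $x\in K$, and the mean value inequality finishes.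
  have hO' : IsOpen (O ∩ (fun p => ‖fderiv ℝ G p‖) ⁻¹' Iio C) :=
    hf.norm.isOpen_inter_preimage hO isOpen_Iio
  obtain ⟨u, v, hu, hv, h0u, hKv, huv⟩ := generalized_tube_lemma (isCompact_singleton (x := (0 : ℝ)))
    hK hO' (by
      rintro ⟨t, x⟩ ⟨ht, hx⟩
      obtain rfl : t = 0 := ht
      exact ⟨hKO x hx, ((hB x hx).trans (le_max_left B 0)).trans_lt (lt_add_one _)⟩)
  obtain ⟨δ, hδ, hδu⟩ := Metric.isOpen_iff.1 hu 0 (h0u rfl)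
  refine ⟨δ, hδ, C, hCpos.le, fun t ht x hx => ?_⟩
  have hmem : ∀ s ∈ Metric.ball (0 : ℝ) δ, (s, x) ∈ O ∩ (fun p => ‖fderiv ℝ G p‖) ⁻¹' Iio C :=
    fun s hs => huv ⟨hδu hs, hKv hx⟩
  have htb : t ∈ Metric.ball (0 : ℝ) δ := by simpa using ht
  refine ⟨(hmem t htb).1, ?_⟩
  have := (convex_ball (0 : ℝ) δ).norm_image_sub_le_of_norm_hasDerivWithin_le
    (f := fun s => G (s, x)) (f' := fun s => fderiv ℝ G (s, x) (1, 0)) (C := C)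
    (fun s hs => by
      have h1 : HasFDerivAt G (fderiv ℝ G (s, x)) (s, x) :=
        ((hG.contDiffAt (hO.mem_nhds (hmem s hs).1)).differentiableAt one_ne_zero).hasFDerivAt
      have h2 : HasDerivAt (fun s : ℝ => (s, x)) ((1 : ℝ), (0 : X)) s :=
        (hasDerivAt_id s).prodMk (hasDerivAt_const s x)
      exact (h1.comp_hasDerivAt s h2).hasDerivWithinAt)
    (fun s hs => by
      refine ((fderiv ℝ G (s, x)).le_opNorm _).trans ?_
      have : ‖((1 : ℝ), (0 : X))‖ = 1 := by simp [Prod.norm_def]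
      rw [this, mul_one]
      exact (hmem s hs).2.le)
    (Metric.mem_ball_self hδ) htb
  simpa using this

/-- Differentiation under the integral sign over a set of finite measure. -/
theorem hasDerivAt_integral_of_bound {α : Type*} [MeasurableSpace α] {μ : Measure α}
    [IsFiniteMeasure μ] {F : ℝ → α → ℝ} {F' : α → ℝ} {C δ : ℝ} (hδ : 0 < δ)
    (hF_meas : ∀ t, |t| < δ → AEStronglyMeasurable (F t) μ) (hF_int : Integrable (F 0) μ)
    (hF'_meas : AEStronglyMeasurable F' μ)
    (h_lip : ∀ᵐ a ∂μ, ∀ t, |t| < δ → |F t a - F 0 a| ≤ C * |t|)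
    (h_diff : ∀ᵐ a ∂μ, HasDerivAt (F · a) (F' a) 0) :
    HasDerivAt (fun t => ∫ a, F t a ∂μ) (∫ a, F' a ∂μ) 0 := by
  set L : ℝ →L[ℝ] ℝ →L[ℝ] ℝ := ContinuousLinearMap.smulRightL ℝ ℝ ℝ 1
  obtain ⟨hi, key⟩ := hasFDerivAt_integral_of_dominated_loc_of_lip' (𝕜 := ℝ) (μ := μ) (F := F)
    (F' := fun a => L (F' a)) (x₀ := 0) (s := Metric.ball 0 δ) (bound := fun _ => C)
    (Metric.ball_mem_nhds _ hδ) (fun t ht => hF_meas t (by simpa using ht)) hF_int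
    (L.continuous.comp_aestronglyMeasurable hF'_meas)
    (h_lip.mono fun a ha t ht => by simpa using ha t (by simpa using ht))
    (integrable_const C) (h_diff.mono fun a ha => ha.hasFDerivAt)
  have hF'_int : Integrable F' μ := by
    refine hi.mono hF'_meas (Eventually.of_forall fun a => ?_)
    simp [L]
  rw [hasDerivAt_iff_hasFDerivAt]
  rw [ContinuousLinearMap.integral_comp_comm _ hF'_int] at key
  exact key

end Analysis

/-! ### Deformations and the first variation formula -/

section FirstVariation

variable {n : ℕ} {M U K : Set (E n)} {ε : ℝ} {φ : ℝ → E n → E n}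

local notation "ℋ" => Measure.hausdorffMeasure ((n : ℝ) - 1)

/-- Continuous functions are integrable over compact subsets of a hypersurface. -/
theorem IsC2Hypersurface.integrableOn (hM : IsC2Hypersurface M) {S : Set (E n)}
    (hS : IsCompact S) (hSM : S ⊆ M) {g : E n → ℝ} (hg : ContinuousOn g S) :
    IntegrableOn g S ℋ := by
  have : IsFiniteMeasure ((ℋ).restrict S) := ⟨by simpa using hM.hausdorffMeasure_lt_top hS hSM⟩
  obtain ⟨B, hB⟩ := hS.exists_bound_of_continuousOn hg
  exact Integrable.of_bound (hg.aestronglyMeasurable hS.measurableSet) B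
    ((ae_restrict_mem hS.measurableSet).mono hB)

/-- The space derivative `D_x φ_t` of a family of maps. -/
noncomputable def spaceDeriv (φ : ℝ → E n → E n) (p : ℝ × E n) : E n →L[ℝ] E n :=
  (fderiv ℝ (fun p : ℝ × E n => φ p.1 p.2) p) ∘L ContinuousLinearMap.inr ℝ ℝ (E n)

/-- The velocity field `∂_t φ_t` of a family of maps at `t = 0`. -/
noncomputable def velocity (φ : ℝ → E n → E n) (x : E n) : E n :=
  fderiv ℝ (fun p : ℝ × E n => φ p.1 p.2) (0, x) (1, 0)

/-- The mixed derivative `∂_t D_x φ_t` of a family of maps at `t = 0`. -/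
noncomputable def velocityDeriv (φ : ℝ → E n → E n) (x : E n) : E n →L[ℝ] E n :=
  fderiv ℝ (spaceDeriv φ) (0, x) (1, 0)

namespace IsDeformation

theorem isOpen_domain (ε : ℝ) : IsOpen (Ioo (-ε) ε ×ˢ (univ : Set (E n))) :=
  isOpen_Ioo.prod isOpen_univ

theorem zero_mem (h : IsDeformation U K ε φ) (x : E n) :
    ((0 : ℝ), x) ∈ Ioo (-ε) ε ×ˢ (univ : Set (E n)) :=
  ⟨⟨neg_lt_zero.2 h.pos, h.pos⟩, mem_univ _⟩

theorem hasFDerivAt (h : IsDeformation U K ε φ) {p : ℝ × E n}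
    (hp : p ∈ Ioo (-ε) ε ×ˢ (univ : Set (E n))) :
    HasFDerivAt (fun p : ℝ × E n => φ p.1 p.2)
      (fderiv ℝ (fun p : ℝ × E n => φ p.1 p.2) p) p :=
  ((h.contDiffOn.contDiffAt ((isOpen_domain ε).mem_nhds hp)).differentiableAt
    two_ne_zero).hasFDerivAt

theorem hasFDerivAt_space (h : IsDeformation U K ε φ) {t : ℝ} (ht : t ∈ Ioo (-ε) ε) (x : E n) :
    HasFDerivAt (φ t) (spaceDeriv φ (t, x)) x := by
  have h1 := h.hasFDerivAt (p := (t, x)) ⟨ht, mem_univ _⟩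
  have h2 : HasFDerivAt (fun x : E n => (t, x)) (ContinuousLinearMap.inr ℝ ℝ (E n)) x :=
    hasFDerivAt_prodMk_right t x
  exact HasFDerivAt.comp x h1 h2

theorem contDiff (h : IsDeformation U K ε φ) {t : ℝ} (ht : t ∈ Ioo (-ε) ε) :
    ContDiff ℝ 2 (φ t) := by
  rw [← contDiffOn_univ]
  exact h.contDiffOn.comp (f := fun x : E n => (t, x)) (by fun_prop)
    fun x _ => ⟨ht, mem_univ _⟩

theorem contDiffOn_spaceDeriv (h : IsDeformation U K ε φ) :
    ContDiffOn ℝ 1 (spaceDeriv φ) (Ioo (-ε) ε ×ˢ (univ : Set (E n))) :=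
  (h.contDiffOn.fderiv_of_isOpen (isOpen_domain ε) (by norm_num)).clm_comp contDiffOn_const

theorem spaceDeriv_zero (h : IsDeformation U K ε φ) (x : E n) : spaceDeriv φ (0, x) = 1 := by
  have h1 := h.hasFDerivAt_space (h.zero_mem x).1 x
  have h2 : φ 0 = id := funext h.zero
  rw [h2] at h1
  exact h1.unique (hasFDerivAt_id x)

theorem hasDerivAt_velocity (h : IsDeformation U K ε φ) (x : E n) :
    HasDerivAt (fun t => φ t x) (velocity φ x) 0 :=
  HasFDerivAt.comp_hasDerivAt (0 : ℝ) (h.hasFDerivAt (h.zero_mem x))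
    ((hasDerivAt_id (0 : ℝ)).prodMk (hasDerivAt_const (0 : ℝ) x))

theorem hasDerivAt_velocityDeriv (h : IsDeformation U K ε φ) (x : E n) :
    HasDerivAt (fun t => spaceDeriv φ (t, x)) (velocityDeriv φ x) 0 := by
  have h1 : HasFDerivAt (spaceDeriv φ) (fderiv ℝ (spaceDeriv φ) (0, x)) ((0 : ℝ), x) :=
    ((h.contDiffOn_spaceDeriv.contDiffAt
      ((isOpen_domain ε).mem_nhds (h.zero_mem x))).differentiableAt one_ne_zero).hasFDerivAt
  have h2 : HasDerivAt (fun t : ℝ => (t, x)) ((1 : ℝ), (0 : E n)) 0 :=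
    (hasDerivAt_id (0 : ℝ)).prodMk (hasDerivAt_const (0 : ℝ) x)
  exact HasFDerivAt.comp_hasDerivAt (0 : ℝ) h1 h2

theorem continuous_velocity (h : IsDeformation U K ε φ) : Continuous (velocity φ) := by
  have h1 := h.contDiffOn.continuousOn_fderiv_of_isOpen (isOpen_domain ε) (by norm_num)
  have h2 : Continuous fun x : E n =>
      fderiv ℝ (fun p : ℝ × E n => φ p.1 p.2) ((0 : ℝ), x) :=
    h1.comp_continuous (by fun_prop) fun x => h.zero_mem x
  exact h2.clm_apply continuous_const

theorem continuous_velocityDeriv (h : IsDeformation U K ε φ) : Continuous (velocityDeriv φ) := by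
  have h1 := h.contDiffOn_spaceDeriv.continuousOn_fderiv_of_isOpen (isOpen_domain ε) le_rfl
  have h2 : Continuous fun x : E n => fderiv ℝ (spaceDeriv φ) ((0 : ℝ), x) :=
    h1.comp_continuous (by fun_prop) fun x => h.zero_mem x
  exact h2.clm_apply continuous_const

/-- For small times the maps of a deformation expand distances by a factor of at least `1/2`. -/
theorem exists_antilipschitz (h : IsDeformation U K ε φ) :
    ∃ δ > 0, δ ≤ ε ∧ ∀ t : ℝ, |t| < δ → ∀ x y, ‖x - y‖ ≤ 2 * ‖φ t x - φ t y‖ := by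
  obtain ⟨δ, hδ, C, hC, hL⟩ := exists_uniform_lipschitz (isOpen_domain ε) h.contDiffOn_spaceDeriv
    h.isCompact fun x _ => h.zero_mem x
  -- The last bound makes $C|t|\le\frac12$, so $D\varphi_t-1$ has norm at most $\frac12$ on $K$. Off
  -- the closed set $K$ the map is locally the identity, hence $\varphi_t-\mathrm{id}$ is
  -- $\frac12$-Lipschitz everywhere.
  refine ⟨min (min δ ε) (1 / (2 * (C + 1))), by have := h.pos; positivity,
    (min_le_left _ _).trans (min_le_right _ _), fun t ht x y => ?_⟩
  have htδ : |t| < δ := ht.trans_le ((min_le_left _ _).trans (min_le_left _ _))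
  have htε : t ∈ Ioo (-ε) ε := abs_lt.1 (ht.trans_le ((min_le_left _ _).trans (min_le_right _ _)))
  have htC : C * |t| ≤ 1 / 2 := by
    have : |t| ≤ 1 / (2 * (C + 1)) := (ht.trans_le (min_le_right _ _)).le
    calc C * |t| ≤ C * (1 / (2 * (C + 1))) := by gcongr
      _ ≤ 1 / 2 := by rw [mul_one_div, div_le_div_iff₀ (by positivity) (by positivity)]; linarith
  have hb : ∀ z, ‖spaceDeriv φ (t, z) - 1‖ ≤ 1 / 2 := by
    intro z
    by_cases hz : z ∈ K
    · have := (hL t htδ z hz).2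
      rw [h.spaceDeriv_zero] at this
      exact this.trans htC
    · have h1 : HasFDerivAt (φ t) (1 : E n →L[ℝ] E n) z := by
        refine (hasFDerivAt_id z).congr_of_eventuallyEq ?_
        filter_upwards [h.isCompact.isClosed.isOpen_compl.mem_nhds hz] with w hw
        exact h.eq_self t htε w hw
      rw [(h.hasFDerivAt_space htε z).unique h1, sub_self, norm_zero]
      norm_num
  have := convex_univ.norm_image_sub_le_of_norm_hasFDerivWithin_le
    (f := fun z => φ t z - z) (f' := fun z => spaceDeriv φ (t, z) - 1) (C := 1 / 2)
    (fun z _ => ((h.hasFDerivAt_space htε z).sub (hasFDerivAt_id z)).hasFDerivWithinAt)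
    (fun z _ => hb z) (mem_univ y) (mem_univ x)
  have h3 : φ t x - x - (φ t y - y) = -((x - y) - (φ t x - φ t y)) := by abel
  rw [h3, norm_neg] at this
  have h4 := norm_sub_norm_le (x - y) (φ t x - φ t y)
  linarith

end IsDeformation

/-- The first variation of the weighted area. -/
theorem IsC2Hypersurface.hasDerivAt_weightedArea (hM : IsC2Hypersurface M)
    (h : IsDeformation U K ε φ) (hMK : IsCompact (M ∩ K)) {O : Set (E n)} (hO : IsOpen O)
    (hKO : K ⊆ O) {f : E n → ℝ} (hf : ContDiffOn ℝ 1 f O) :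
    HasDerivAt (fun t => weightedArea f (φ t '' (M ∩ K)))
      (∫ x in M ∩ K, (LinearMap.trace ℝ (E n)
        ((ContinuousLinearMap.adjoint (velocityDeriv φ x) + velocityDeriv φ x) ∘L tangentProj M x :
          E n →L[ℝ] E n) / 2 * f x + fderiv ℝ f x (velocity φ x)) ∂ℋ) 0 := by
  obtain ⟨δ₁, hδ₁, hδ₁ε, hanti⟩ := h.exists_antilipschitz
  have hS : M ∩ K ⊆ M := inter_subset_left
  have hfin : IsFiniteMeasure ((ℋ).restrict (M ∩ K)) :=
    ⟨by simpa using hM.hausdorffMeasure_lt_top hMK hS⟩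
  set N : ℝ → E n → E n →L[ℝ] E n := fun t x => metricDefect M (spaceDeriv φ (t, x)) x with hN
  set F : ℝ → E n → ℝ := fun t x => √(1 + N t x).det * f (φ t x) with hF
  have hdisp : ∀ t, |t| < δ₁ → weightedArea f (φ t '' (M ∩ K)) = ∫ x in M ∩ K, F t x ∂ℋ := by
    intro t ht
    have htε : t ∈ Ioo (-ε) ε := abs_lt.1 (ht.trans_le hδ₁ε)
    rw [weightedArea, hM.setIntegral_image hMK hS ((h.contDiff htε).of_le (by norm_num))
      (hanti t ht)]
    refine integral_congr_ae (Eventually.of_forall fun x => ?_)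
    simp only [hF, hN, tangentialJacobian_eq_sqrt, (h.hasFDerivAt_space htε x).fderiv]
  -- $N_t=G(t,\cdot)\circ P$, where $G$ is $C^1$ in $(t,x)$ and $P$ is independent of $t$ with norm
  -- at most 1. The Lipschitz bound in $t$ therefore passes from $G$ to $N$ without any
  -- differentiability of $P$ in $x$.
  set G : ℝ × E n → E n →L[ℝ] E n := fun p => adjointL (spaceDeriv φ p) ∘L spaceDeriv φ p - 1
    with hG
  have hadjc : ContDiffOn ℝ 1 (fun p => adjointL (spaceDeriv φ p))
      (Ioo (-ε) ε ×ˢ (univ : Set (E n))) := by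
    have h1 : ContDiff ℝ 1 (adjointL (V := E n)) := (adjointL (V := E n)).contDiff
    exact h1.comp_contDiffOn h.contDiffOn_spaceDeriv
  have hGc : ContDiffOn ℝ 1 G (Ioo (-ε) ε ×ˢ (univ : Set (E n))) := by
    have h1 := hadjc.clm_comp h.contDiffOn_spaceDeriv
    exact h1.sub (contDiffOn_const (c := (1 : E n →L[ℝ] E n)))
  have hG0 : ∀ x, G (0, x) = 0 := by
    intro x
    simp only [hG, h.spaceDeriv_zero, adjointL_apply]
    rw [← ContinuousLinearMap.star_eq_adjoint, star_one]
    exact sub_self _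
  have hN0 : ∀ x, N 0 x = 0 := fun x => by
    have : N 0 x = G (0, x) ∘L tangentProj M x := rfl
    rw [this, hG0, ContinuousLinearMap.zero_comp]
  have hdet1 : √(1 + (0 : E n →L[ℝ] E n)).det = 1 := by
    have : (1 + (0 : E n →L[ℝ] E n)).det = 1 := by rw [add_zero]; exact LinearMap.det_id
    rw [this, Real.sqrt_one]
  have hF0 : ∀ x, F 0 x = f x := fun x => by simp only [hF, hN0, hdet1, h.zero, one_mul]
  set O' : Set (ℝ × E n) := (Ioo (-ε) ε ×ˢ univ) ∩ (fun p => φ p.1 p.2) ⁻¹' O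
  have hO' : IsOpen O' := h.contDiffOn.continuousOn.isOpen_inter_preimage
    (IsDeformation.isOpen_domain ε) hO
  have hfφ : ContDiffOn ℝ 1 (fun p : ℝ × E n => f (φ p.1 p.2)) O' :=
    hf.comp ((h.contDiffOn.of_le (by norm_num)).mono inter_subset_left) inter_subset_right
  obtain ⟨δ₂, hδ₂, C₂, hC₂, hL₂⟩ := exists_uniform_lipschitz (IsDeformation.isOpen_domain ε) hGc
    h.isCompact fun x _ => h.zero_mem x
  obtain ⟨δ₃, hδ₃, C₃, hC₃, hL₃⟩ := exists_uniform_lipschitz hO' hfφ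
    h.isCompact fun x hx => ⟨h.zero_mem x, by simpa [h.zero] using hKO hx⟩
  obtain ⟨δ₄, hδ₄, C₄, hC₄, hdet⟩ := exists_sqrt_det_bound (V := E n)
  obtain ⟨B, hB⟩ := hMK.exists_bound_of_continuousOn
    (hf.continuousOn.mono (inter_subset_right.trans hKO))
  set δ := min (min (min δ₁ δ₂) (min δ₃ 1)) (δ₄ / (C₂ + 1)) with hδdef
  have hδ : 0 < δ := by positivity
  have hNb : ∀ t, |t| < δ → ∀ x ∈ K, ‖N t x‖ ≤ C₂ * |t| := by
    intro t ht x hx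
    have h1 := (hL₂ t (ht.trans_le ((min_le_left _ _).trans ((min_le_left _ _).trans
      (min_le_right _ _)))) x hx).2
    rw [hG0, sub_zero] at h1
    calc ‖N t x‖ ≤ ‖G (t, x)‖ * ‖tangentProj M x‖ := ContinuousLinearMap.opNorm_comp_le _ _
      _ ≤ ‖G (t, x)‖ * 1 := by gcongr; exact Submodule.starProjection_norm_le _
      _ ≤ _ := by rwa [mul_one]
  have hNc : ∀ t ∈ Ioo (-ε) ε, ContinuousOn (N t) M := by
    intro t ht
    have h1 : Continuous fun x : E n => G (t, x) := by
      refine hGc.continuousOn.comp_continuous (by fun_prop) fun x => ⟨ht, mem_univ _⟩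
    exact h1.continuousOn.clm_comp hM.continuousOn_tangentProj
  have key := hasDerivAt_integral_of_bound (μ := (ℋ).restrict (M ∩ K)) (F := F)
    (F' := fun x => LinearMap.trace ℝ (E n)
        ((ContinuousLinearMap.adjoint (velocityDeriv φ x) + velocityDeriv φ x) ∘L tangentProj M x :
          E n →L[ℝ] E n) / 2 * f x + fderiv ℝ f x (velocity φ x))
    (C := C₄ * C₂ * (B + C₃) + C₃) hδ ?_ ?_ ?_ ?_ ?_
  · refine key.congr_of_eventuallyEq ?_
    filter_upwards [Metric.ball_mem_nhds (0 : ℝ) hδ₁] with t ht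
    exact hdisp t (by simpa using ht)
  · intro t ht
    have ht1 : |t| < δ₁ := ht.trans_le ((min_le_left _ _).trans ((min_le_left _ _).trans
      (min_le_left _ _)))
    have ht3 : |t| < δ₃ := ht.trans_le ((min_le_left _ _).trans ((min_le_right _ _).trans
      (min_le_left _ _)))
    have htε : t ∈ Ioo (-ε) ε := abs_lt.1 (ht1.trans_le hδ₁ε)
    refine ContinuousOn.aestronglyMeasurable ?_ hMK.measurableSet
    refine ContinuousOn.mul ?_ ?_
    · exact (ContinuousLinearMap.continuous_det.comp_continuousOn
        (continuousOn_const.add ((hNc t htε).mono hS))).sqrt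
    · exact hfφ.continuousOn.comp (f := fun x : E n => (t, x)) (by fun_prop)
        fun x hx => (hL₃ t ht3 x hx.2).1
  · rw [show F 0 = f from funext hF0]
    exact hM.integrableOn hMK hS (hf.continuousOn.mono (inter_subset_right.trans hKO))
  · refine ContinuousOn.aestronglyMeasurable ?_ hMK.measurableSet
    refine ContinuousOn.add (ContinuousOn.mul (ContinuousOn.div_const ?_ 2) ?_) ?_
    · have hT : Continuous fun L : E n →L[ℝ] E n => LinearMap.trace ℝ (E n) (L : E n →ₗ[ℝ] E n) :=
        (LinearMap.toContinuousLinearMap ((LinearMap.trace ℝ (E n)) ∘ₗ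
          ContinuousLinearMap.coeLM ℝ)).continuous
      have hA : Continuous fun x => adjointL (velocityDeriv φ x) + velocityDeriv φ x :=
        (adjointL.continuous.comp h.continuous_velocityDeriv).add h.continuous_velocityDeriv
      exact hT.comp_continuousOn (hA.continuousOn.clm_comp (hM.continuousOn_tangentProj.mono hS))
    · exact hf.continuousOn.mono (inter_subset_right.trans hKO)
    · exact ((hf.continuousOn_fderiv_of_isOpen hO le_rfl).mono
        (inter_subset_right.trans hKO)).clm_apply h.continuous_velocity.continuousOn
  · refine (ae_restrict_mem hMK.measurableSet).mono fun x hx t ht => ?_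
    have ht3 : |t| < δ₃ := ht.trans_le ((min_le_left _ _).trans ((min_le_right _ _).trans
      (min_le_left _ _)))
    have ht1 : |t| ≤ 1 := (ht.trans_le ((min_le_left _ _).trans ((min_le_right _ _).trans
      (min_le_right _ _)))).le
    have h1 := hNb t ht x hx.2
    have h2 := (hL₃ t ht3 x hx.2).2
    have h3 : ‖N t x‖ < δ₄ := by
      have h4 : |t| < δ₄ / (C₂ + 1) := ht.trans_le (min_le_right _ _)
      rw [lt_div_iff₀ (by positivity)] at h4
      nlinarith [abs_nonneg t]
    have h4 := hdet _ h3
    have h5 := hB x hx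
    simp only [h.zero, Real.norm_eq_abs] at h2 h5
    rw [hF0]
    -- Splitting the change of the Jacobian from that of the density gives the constant
    -- $C_4C_2(B+C_3)+C_3$; $|f\circ\varphi_t|\le B+C_3$ uses $|t|\le1$.
    have h6 : F t x - f x = (√(1 + N t x).det - 1) * f (φ t x) + (f (φ t x) - f x) := by
      simp only [hF]; ring
    have h7 : |f (φ t x)| ≤ B + C₃ := by
      have := abs_sub_abs_le_abs_sub (f (φ t x)) (f x)
      nlinarith
    rw [h6]
    refine (abs_add_le _ _).trans ?_
    rw [abs_mul]
    calc _ ≤ C₄ * (C₂ * |t|) * (B + C₃) + C₃ * |t| := by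
          gcongr
          exact h4.trans (by gcongr)
      _ = _ := by ring
  · refine (ae_restrict_mem hMK.measurableSet).mono fun x hx => ?_
    have hA := h.hasDerivAt_velocityDeriv x
    have hadj : HasDerivAt (fun t => adjointL (spaceDeriv φ (t, x)))
        (adjointL (velocityDeriv φ x)) 0 := by
      have h1 : HasFDerivAt (adjointL (V := E n)) (adjointL (V := E n)) (spaceDeriv φ (0, x)) :=
        (adjointL (V := E n)).hasFDerivAt
      exact HasFDerivAt.comp_hasDerivAt (0 : ℝ) h1 hA
    -- Since $D\varphi_0=1$, the derivative of $A^\dagger A$ is $Z^\dagger+Z$. Half the trace of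
    -- $(Z^\dagger+Z)P$ is the tangential divergence of the velocity.
    have hNd : HasDerivAt (fun t => N t x)
        ((adjointL (velocityDeriv φ x) + velocityDeriv φ x) ∘L tangentProj M x) 0 := by
      have h1 := ((hadj.clm_comp hA).sub_const 1).clm_comp
        (hasDerivAt_const (0 : ℝ) (tangentProj M x))
      refine h1.congr_deriv ?_
      rw [h.spaceDeriv_zero, ContinuousLinearMap.comp_zero, add_zero, adjointL_apply,
        adjointL_apply, ← ContinuousLinearMap.star_eq_adjoint, ← ContinuousLinearMap.star_eq_adjoint,
        star_one]
      rfl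
    have hs := hasDerivAt_sqrt_det (hN0 x) hNd
    have hfd : HasDerivAt (fun t => f (φ t x)) (fderiv ℝ f x (velocity φ x)) 0 := by
      have h1 : HasFDerivAt f (fderiv ℝ f x) (φ 0 x) := by
        rw [h.zero]
        exact ((hf.contDiffAt (hO.mem_nhds (hKO hx.2))).differentiableAt one_ne_zero).hasFDerivAt
      exact HasFDerivAt.comp_hasDerivAt (0 : ℝ) h1 (h.hasDerivAt_velocity x)
    refine (hs.mul hfd).congr_deriv ?_
    rw [hN0, hdet1, h.zero, one_mul, adjointL_apply]

end FirstVariation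

/-! ### Transfer of stationarity to the weighted area -/

section Stationary

variable {n : ℕ} {M U K : Set (E n)} {ε : ℝ} {φ : ℝ → E n → E n}

local notation "ℋ" => Measure.hausdorffMeasure ((n : ℝ) - 1)

theorem hasDerivAt_smul_self {F : Type*} [NormedAddCommGroup F] [NormedSpace ℝ F] {B : ℝ → F}
    (hB : ContinuousAt B 0) : HasDerivAt (fun t => t • B t) (B 0) 0 := by
  rw [hasDerivAt_iff_tendsto_slope]
  refine (hB.tendsto.mono_left nhdsWithin_le_nhds).congr' ?_
  filter_upwards [self_mem_nhdsWithin] with t ht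
  have ht' : t ≠ 0 := ht
  simp [slope_def_module, ht']

open Classical in
/-- The deformation `x ↦ φ_{t f(x)}(x)`, whose velocity is that of `φ` multiplied by `f`. -/
theorem IsDeformation.exists_rescaled (h : IsDeformation U K ε φ) {O : Set (E n)} (hO : IsOpen O)
    (hKO : K ⊆ O) {f : E n → ℝ} (hf : ContDiffOn ℝ 2 f O) :
    ∃ (ε' : ℝ) (ψ : ℝ → E n → E n), IsDeformation U K ε' ψ ∧ ∀ x ∈ K,
      velocityDeriv ψ x = f x • velocityDeriv φ x + (fderiv ℝ f x).smulRight (velocity φ x) := by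
  obtain ⟨B, hB⟩ := h.isCompact.exists_bound_of_continuousOn (hf.continuousOn.mono hKO)
  -- A strict bound of $|f|$ on a neighbourhood of $K$; times $|t|<\varepsilon/R$ keep $tf(x)$ in
  -- $(-\varepsilon,\varepsilon)$.
  set R := max B 0 + 1 with hR
  have hRpos : 0 < R := by positivity
  set O' := O ∩ (fun x => ‖f x‖) ⁻¹' Iio R
  have hO' : IsOpen O' := hf.continuousOn.norm.isOpen_inter_preimage hO isOpen_Iio
  have hKO' : K ⊆ O' := fun x hx =>
    ⟨hKO hx, ((hB x hx).trans (le_max_left B 0)).trans_lt (lt_add_one _)⟩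
  set ε' := ε / R
  have hε' : 0 < ε' := div_pos h.pos hRpos
  -- Far from $K$ nothing is known about $f$, so the formula is cut off there. No regularity is
  -- lost: on the neighbourhood $O'$ of $K$ both branches agree, because $\varphi_s$ is the identity
  -- off $K$.
  set ψ : ℝ → E n → E n := fun t x => if x ∈ K then φ (t * f x) x else x with hψ
  have hrange : ∀ t ∈ Ioo (-ε') ε', ∀ x ∈ O', t * f x ∈ Ioo (-ε) ε := by
    intro t ht x hx
    refine abs_lt.1 ?_
    rw [abs_mul]
    have h1 : |t| < ε / R := abs_lt.2 ht
    have h2 : |f x| < R := hx.2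
    rw [lt_div_iff₀ hRpos] at h1
    nlinarith [abs_nonneg t, abs_nonneg (f x)]
  have hψO : ∀ t ∈ Ioo (-ε') ε', ∀ x ∈ O', ψ t x = φ (t * f x) x := by
    intro t ht x hx
    by_cases hxK : x ∈ K
    · simp [hψ, hxK]
    · simp [hψ, hxK, h.eq_self _ (hrange t ht x hx) x hxK]
  have hψdef : IsDeformation U K ε' ψ := by
    refine ⟨hε', h.isCompact, h.subset, ?_, ?_, ?_⟩
    · rintro ⟨t, x⟩ ⟨ht, -⟩
      refine ContDiffAt.contDiffWithinAt ?_
      by_cases hx : x ∈ K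
      · have hnhds : Ioo (-ε') ε' ×ˢ O' ∈ 𝓝 (t, x) :=
          (isOpen_Ioo.prod hO').mem_nhds ⟨ht, hKO' hx⟩
        have hfx : ContDiffAt ℝ 2 f x := hf.contDiffAt (hO.mem_nhds (hKO hx))
        have h1 : ContDiffAt ℝ 2 (fun p : ℝ × E n => (p.1 * f p.2, p.2)) (t, x) :=
          (contDiffAt_fst.mul (hfx.comp (t, x) contDiffAt_snd)).prodMk contDiffAt_snd
        have h2 : ContDiffAt ℝ 2 (fun p : ℝ × E n => φ p.1 p.2) (t * f x, x) :=
          h.contDiffOn.contDiffAt ((IsDeformation.isOpen_domain ε).mem_nhds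
            ⟨hrange t ht x (hKO' hx), mem_univ _⟩)
        have h3 : ContDiffAt ℝ 2 (fun p : ℝ × E n => φ (p.1 * f p.2) p.2) (t, x) :=
          ContDiffAt.comp (g := fun p : ℝ × E n => φ p.1 p.2)
            (f := fun p : ℝ × E n => (p.1 * f p.2, p.2)) (t, x) h2 h1
        refine h3.congr_of_eventuallyEq ?_
        filter_upwards [hnhds] with p hp using hψO p.1 hp.1 p.2 hp.2
      · refine contDiffAt_snd.congr_of_eventuallyEq ?_
        have : (univ : Set ℝ) ×ˢ Kᶜ ∈ 𝓝 (t, x) :=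
          (isOpen_univ.prod h.isCompact.isClosed.isOpen_compl).mem_nhds ⟨mem_univ _, hx⟩
        filter_upwards [this] with p hp
        simp [hψ, show p.2 ∉ K from hp.2]
    · intro x
      simp [hψ, h.zero]
    · intro t _ x hx
      simp [hψ, hx]
  refine ⟨ε', ψ, hψdef, fun x hx => ?_⟩
  have hdf : HasFDerivAt f (fderiv ℝ f x) x :=
    ((hf.contDiffAt (hO.mem_nhds (hKO hx))).differentiableAt two_ne_zero).hasFDerivAt
  have hspace : ∀ t ∈ Ioo (-ε') ε', spaceDeriv ψ (t, x) = spaceDeriv φ (t * f x, x) +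
      t • (fderiv ℝ f x).smulRight
        (fderiv ℝ (fun p : ℝ × E n => φ p.1 p.2) (t * f x, x) (1, 0)) := by
    intro t ht
    have h1 : HasFDerivAt (fun y : E n => (t * f y, y))
        ((t • fderiv ℝ f x).prod (ContinuousLinearMap.id ℝ (E n))) x :=
      (hdf.const_mul t).prodMk (hasFDerivAt_id x)
    have h2 := h.hasFDerivAt (p := (t * f x, x)) ⟨hrange t ht x (hKO' hx), mem_univ _⟩
    have h3 : HasFDerivAt (fun y : E n => φ (t * f y) y) _ x := 
      HasFDerivAt.comp (g := fun p : ℝ × E n => φ p.1 p.2) (f := fun y : E n => (t * f y, y)) x h2 h1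
    have h4 : HasFDerivAt (ψ t) _ x := h3.congr_of_eventuallyEq (by
      filter_upwards [hO'.mem_nhds (hKO' hx)] with y hy using hψO t ht y hy)
    rw [(hψdef.hasFDerivAt_space ht x).unique h4]
    ext1 v
    have h5 : ((t • fderiv ℝ f x).prod (ContinuousLinearMap.id ℝ (E n))) v =
        ContinuousLinearMap.inr ℝ ℝ (E n) v + (t * fderiv ℝ f x v) • ((1 : ℝ), (0 : E n)) := by
      simp
    rw [ContinuousLinearMap.comp_apply, h5, map_add, map_smul]
    simp [spaceDeriv, mul_smul]
  have hlin : HasDerivAt (fun t : ℝ => t * f x) (f x) 0 := by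
    simpa using (hasDerivAt_id (0 : ℝ)).mul_const (f x)
  have hd1 : HasDerivAt (fun t : ℝ => spaceDeriv φ (t * f x, x)) (f x • velocityDeriv φ x) 0 := by
    have h1 : HasDerivAt (fun s => spaceDeriv φ (s, x)) (velocityDeriv φ x) (0 * f x) := by
      rw [zero_mul]; exact h.hasDerivAt_velocityDeriv x
    exact HasDerivAt.scomp (0 : ℝ) h1 hlin
  -- This term carries an explicit factor $t$, so continuity at $0$ suffices to differentiate it
  -- there.
  have hc : ContinuousAt (fun t : ℝ => (fderiv ℝ f x).smulRight
      (fderiv ℝ (fun p : ℝ × E n => φ p.1 p.2) (t * f x, x) ((1 : ℝ), (0 : E n)))) 0 := by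
    have h1 : ContinuousAt (fderiv ℝ (fun p : ℝ × E n => φ p.1 p.2)) (0 * f x, x) := by
      rw [zero_mul]
      exact (h.contDiffOn.continuousOn_fderiv_of_isOpen (IsDeformation.isOpen_domain ε)
        (by norm_num)).continuousAt ((IsDeformation.isOpen_domain ε).mem_nhds (h.zero_mem x))
    have h2 : ContinuousAt (fun t : ℝ => fderiv ℝ (fun p : ℝ × E n => φ p.1 p.2) (t * f x, x)) 0 :=
      ContinuousAt.comp (f := fun t : ℝ => (t * f x, x)) (x := (0 : ℝ)) h1 (by fun_prop)
    exact (ContinuousLinearMap.smulRightL ℝ (E n) (E n) (fderiv ℝ f x)).continuous.continuousAt.comp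
      (h2.clm_apply continuousAt_const)
  have hd2 := hasDerivAt_smul_self hc
  refine (hψdef.hasDerivAt_velocityDeriv x).unique ?_
  refine ((hd1.add hd2).congr_of_eventuallyEq ?_).congr_deriv ?_
  · filter_upwards [Ioo_mem_nhds (neg_lt_zero.2 hε') hε'] with t ht using hspace t ht
  · rw [zero_mul]
    rfl

/-- Adding `v ⊗ ℓ` to a velocity derivative, with `ℓ` vanishing on normal vectors, adds `ℓ(v)` to
the tangential divergence. -/
theorem trace_add_smulRight_comp_tangentProj {x : E n} (ℓ : E n →L[ℝ] ℝ)
    (hℓ : ∀ w, ℓ (normalProj M x w) = 0) (c : ℝ) (Z : E n →L[ℝ] E n) (v : E n) :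
    LinearMap.trace ℝ (E n) ((ContinuousLinearMap.adjoint (c • Z + ℓ.smulRight v) +
      (c • Z + ℓ.smulRight v)) ∘L tangentProj M x : E n →L[ℝ] E n) / 2 =
    LinearMap.trace ℝ (E n) ((ContinuousLinearMap.adjoint Z + Z) ∘L tangentProj M x :
      E n →L[ℝ] E n) / 2 * c + ℓ v := by
  have hP : ∀ w, ℓ (tangentProj M x w) = ℓ w := by
    intro w
    rw [tangentProj_eq]
    simp [hℓ]
  set g := (InnerProductSpace.toDual ℝ (E n)).symm ℓ with hg
  have hgi : ∀ w, inner ℝ g w = ℓ w := fun w => InnerProductSpace.toDual_symm_apply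
  have hr : ℓ.smulRight v = InnerProductSpace.rankOne ℝ v g := by
    ext1 w
    simp [InnerProductSpace.rankOne_apply, hgi]
  -- With $g$ the Riesz vector of $\ell$ and $\ell\circ P=\ell$, the rank-one term and its adjoint
  -- each contribute $\ell(v)$ to the trace; the division by 2 leaves one.
  have h1 : (InnerProductSpace.rankOne ℝ v g) ∘L tangentProj M x =
      InnerProductSpace.rankOne ℝ v g := by
    ext1 w
    simp [InnerProductSpace.rankOne_apply, hgi, hP]
  have h2 : (InnerProductSpace.rankOne ℝ g v) ∘L tangentProj M x =
      InnerProductSpace.rankOne ℝ g (tangentProj M x v) := by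
    ext1 w
    simp only [ContinuousLinearMap.comp_apply, InnerProductSpace.rankOne_apply]
    rw [tangentProj, Submodule.inner_starProjection_left_eq_right]
  have h3 : (ContinuousLinearMap.adjoint (c • Z + ℓ.smulRight v) + (c • Z + ℓ.smulRight v)) ∘L
      tangentProj M x = c • ((ContinuousLinearMap.adjoint Z + Z) ∘L tangentProj M x) +
        InnerProductSpace.rankOne ℝ g (tangentProj M x v) + InnerProductSpace.rankOne ℝ v g := by
    rw [← h2]
    conv_rhs => rw [← h1]
    rw [hr, map_add, InnerProductSpace.adjoint_rankOne]
    simp only [map_smulₛₗ]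
    ext1 w
    simp
    abel
  have h4 := InnerProductSpace.trace_rankOne (𝕜 := ℝ) g (tangentProj M x v)
  have h5 := InnerProductSpace.trace_rankOne (𝕜 := ℝ) v g
  rw [h3, ContinuousLinearMap.toLinearMap_add, ContinuousLinearMap.toLinearMap_add,
    ContinuousLinearMap.toLinearMap_smul, map_add, map_add, map_smul, h4, h5, real_inner_comm, hgi,
    hgi, hP, smul_eq_mul]
  ring

/-- If `M` is stationary for the area and the gradient of `f` is tangent to `M`, then `M` is
stationary for the `f`-weighted area. -/
theorem IsStationary.of_gradient_tangent (hM : IsC2Hypersurface M)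
    (hUM : U ∩ (closure M \ M) = ∅) (hst : IsStationary (fun _ => 1) M U) {O : Set (E n)}
    (hO : IsOpen O) (hUO : U ⊆ O) {f : E n → ℝ} (hf : ContDiffOn ℝ 2 f O)
    (hgrad : ∀ x ∈ M, ∀ w, fderiv ℝ f x (normalProj M x w) = 0) : IsStationary f M U := by
  intro K ε φ h
  -- Inside $U$ the set $M$ has no limit points outside itself, so $M\cap K=\overline M\cap K$.
  have hMK : IsCompact (M ∩ K) := by
    have : M ∩ K = closure M ∩ K := by
      refine Subset.antisymm (inter_subset_inter_left _ subset_closure) fun x hx => ⟨?_, hx.2⟩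
      by_contra hxM
      exact (hUM.subset ⟨h.subset hx.2, hx.1, hxM⟩ : x ∈ (∅ : Set (E n)))
    rw [this]
    exact h.isCompact.inter_left isClosed_closure
  have hKO : K ⊆ O := h.subset.trans hUO
  obtain ⟨ε', ψ, hψ, hvel⟩ := h.exists_rescaled hO hKO hf
  have h1 := hM.hasDerivAt_weightedArea hψ hMK hO hKO (f := fun _ => 1) contDiffOn_const
  have h2 := hM.hasDerivAt_weightedArea h hMK hO hKO (hf.of_le (by norm_num))
  have h3 := h1.unique (hst K ε' ψ hψ)
  refine h2.congr_deriv (Eq.trans ?_ h3)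
  refine setIntegral_congr_fun hMK.measurableSet fun x hx => ?_
  simp only [fderiv_fun_const, Pi.zero_apply, zero_apply, mul_one, add_zero]
  rw [hvel x hx.2, trace_add_smulRight_comp_tangentProj _ (hgrad x hx.1)]

end Stationary

/-! ### Scaling on cones and continuity of the integrands -/

section Radial

variable {n : ℕ} {M U K S : Set (E n)}

local notation "ℋ" => Measure.hausdorffMeasure ((n : ℝ) - 1)

open scoped Pointwise in
/-- On a cone the weighted integrals scale under dilations. -/
theorem integral_smul_of_cone (hn : 0 ≤ (n : ℝ) - 1)
    (hcone : ∀ x ∈ M, ∀ t : ℝ, 0 < t → t • x ∈ M) (g : E n → ℝ) {s : ℝ} (hs : 0 < s) :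
    ∫ x in M, g (s • x) ∂ℋ = s ^ (-((n : ℝ) - 1)) * ∫ x in M, g x ∂ℋ := by
  have hmap : Measure.map (fun x : E n => s • x) ((ℋ).restrict M) =
      ENNReal.ofReal (s ^ (-((n : ℝ) - 1))) • (ℋ).restrict M := by
    ext A hA
    rw [Measure.map_apply (measurable_const_smul s) hA, Measure.smul_apply,
      Measure.restrict_apply hA, Measure.restrict_apply (measurable_const_smul s hA)]
    have h1 : (fun x : E n => s • x) ⁻¹' A ∩ M = s⁻¹ • (A ∩ M) := by
      ext x
      rw [mem_smul_set_iff_inv_smul_mem₀ (inv_ne_zero hs.ne'), inv_inv]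
      refine and_congr Iff.rfl ⟨fun hx => hcone x hx s hs, fun hx => ?_⟩
      have := hcone _ hx s⁻¹ (inv_pos.2 hs)
      rwa [inv_smul_smul₀ hs.ne'] at this
    rw [h1, Measure.hausdorffMeasure_smul₀ hn (inv_ne_zero hs.ne')]
    have h2 : (‖s⁻¹‖₊ : ℝ≥0) ^ ((n : ℝ) - 1) = Real.toNNReal (s ^ (-((n : ℝ) - 1))) := by
      ext
      rw [Real.coe_toNNReal _ (by positivity), Real.rpow_neg hs.le, NNReal.coe_rpow, coe_nnnorm,
        norm_inv, Real.norm_of_nonneg hs.le, Real.inv_rpow hs.le]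
    rw [h2]
    rfl
  have hemb : MeasurableEmbedding fun x : E n => s • x :=
    (Homeomorph.smulOfNeZero s hs.ne').measurableEmbedding
  rw [← hemb.integral_map, hmap, integral_smul_measure, ENNReal.toReal_ofReal (by positivity),
    smul_eq_mul]

/-- Integration by parts along the rays of a cone. -/
theorem IsC2Hypersurface.integral_radial_deriv (hM : IsC2Hypersurface M)
    (hcone : ∀ x ∈ M, ∀ t : ℝ, 0 < t → t • x ∈ M) (hS : IsCompact S) (hSM : S ⊆ M)
    {g G : E n → ℝ} (hg : ContinuousOn g M) (hG : ContinuousOn G M)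
    (hgS : ∀ x ∈ M, x ∉ S → g x = 0) (hGS : ∀ x ∈ M, x ∉ S → G x = 0)
    (hder : ∀ x ∈ M, HasDerivAt (fun s : ℝ => g (s • x)) (G x) 1) :
    ∫ x in M, G x ∂ℋ = -((n : ℝ) - 1) * ∫ x in M, g x ∂ℋ := by
  rcases M.eq_empty_or_nonempty with rfl | ⟨p, hp⟩
  · simp
  have hn := hM.one_le_dim hp
  -- Compact, and containing every $x$ with $sx\in S$ for some $s\in[\frac12,2]$: the dilated
  -- integrands are supported in this one set of finite area.
  set S' : Set (E n) := (fun q : ℝ × E n => q.1⁻¹ • q.2) '' (Icc (1 / 2 : ℝ) 2 ×ˢ S) with hS'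
  have hS'c : IsCompact S' := by
    refine (isCompact_Icc.prod hS).image_of_continuousOn ?_
    refine ContinuousOn.smul (continuousOn_fst.inv₀ fun q hq => ?_) continuousOn_snd
    have := hq.1.1
    intro h0
    rw [h0] at this
    norm_num at this
  have hS'M : S' ⊆ M := by
    rintro _ ⟨⟨s, y⟩, ⟨hs, hy⟩, rfl⟩
    exact hcone y (hSM hy) _ (inv_pos.2 (by linarith [hs.1]))
  have hmemS' : ∀ s ∈ Icc (1 / 2 : ℝ) 2, ∀ x, s • x ∈ S → x ∈ S' := by
    intro s hs x hx
    have hs0 : s ≠ 0 := by linarith [hs.1]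
    exact ⟨(s, s • x), ⟨hs, hx⟩, inv_smul_smul₀ hs0 x⟩
  have hMm := hM.measurableSet
  have hres : ∀ t : ℝ, |t| < 1 / 2 →
      ∫ x in S', g ((1 + t) • x) ∂ℋ = ∫ x in M, g ((1 + t) • x) ∂ℋ := by
    intro t ht
    rw [abs_lt] at ht
    refine (setIntegral_eq_of_subset_of_forall_sdiff_eq_zero hMm hS'M fun x hx => ?_).symm
    refine hgS _ (hcone x hx.1 _ (by linarith)) fun h => hx.2 ?_
    exact hmemS' _ ⟨by linarith, by linarith⟩ x h
  have hfin : IsFiniteMeasure ((ℋ).restrict S') :=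
    ⟨by simpa using hM.hausdorffMeasure_lt_top hS'c hS'M⟩
  obtain ⟨B, hB⟩ := hS.exists_bound_of_continuousOn (hG.mono hSM)
  have hB' : ∀ x ∈ M, |G x| ≤ max B 0 := by
    intro x hx
    by_cases hxS : x ∈ S
    · exact (hB x hxS).trans (le_max_left _ _)
    · rw [hGS x hx hxS, abs_zero]; exact le_max_right _ _
  have hder' : ∀ x ∈ M, ∀ s : ℝ, 0 < s →
      HasDerivAt (fun σ : ℝ => g (σ • x)) (G (s • x) * s⁻¹) s := by
    intro x hx s hs
    have h1 := hder _ (hcone x hx s hs)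
    have h2 : HasDerivAt (fun σ : ℝ => σ * s⁻¹) s⁻¹ s := by
      simpa using (hasDerivAt_id s).mul_const s⁻¹
    have h3 : HasDerivAt (fun σ : ℝ => g (σ • s • x)) (G (s • x)) (s * s⁻¹) := by
      rwa [mul_inv_cancel₀ hs.ne']
    have h4 := HasDerivAt.comp s h3 h2
    refine h4.congr_of_eventuallyEq (Eventually.of_forall fun σ => ?_)
    simp [smul_smul, mul_assoc, inv_mul_cancel₀ hs.ne']
  have key := hasDerivAt_integral_of_bound (μ := (ℋ).restrict S')
    (F := fun t x => g ((1 + t) • x)) (F' := G) (C := 2 * max B 0) (δ := 1 / 2) (by norm_num)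
    ?_ ?_ ?_ ?_ ?_
  · have h1 : HasDerivAt (fun t : ℝ => ∫ x in S', g ((1 + t) • x) ∂ℋ)
        (-((n : ℝ) - 1) * ∫ x in M, g x ∂ℋ) 0 := by
      have h2 : HasDerivAt (fun t : ℝ => (1 + t) ^ (-((n : ℝ) - 1))) (-((n : ℝ) - 1)) 0 := by
        have h3 : HasDerivAt (fun t : ℝ => 1 + t) 1 0 := (hasDerivAt_id (0 : ℝ)).const_add 1
        have h4 := h3.rpow_const (p := -((n : ℝ) - 1)) (Or.inl (by norm_num))
        simpa using h4
      refine (h2.mul_const (∫ x in M, g x ∂ℋ)).congr_of_eventuallyEq ?_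
      filter_upwards [Metric.ball_mem_nhds (0 : ℝ) (by norm_num : (0 : ℝ) < 1 / 2)] with t ht
      have ht' : |t| < 1 / 2 := by simpa using ht
      rw [hres t ht', integral_smul_of_cone hn hcone g (by linarith [(abs_lt.1 ht').1])]
    rw [h1.unique key]
    refine (setIntegral_eq_of_subset_of_forall_sdiff_eq_zero hMm hS'M fun x hx => ?_)
    exact hGS x hx.1 fun h => hx.2 (hmemS' 1 ⟨by norm_num, by norm_num⟩ x (by simpa using h))
  · intro t ht
    refine ContinuousOn.aestronglyMeasurable ?_ hS'c.measurableSet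
    exact hg.comp (by fun_prop) fun x hx => hcone x (hS'M hx) _ (by linarith [(abs_lt.1 ht).1])
  · simp only [add_zero, one_smul]
    exact hM.integrableOn hS'c hS'M (hg.mono hS'M)
  · exact (hG.mono hS'M).aestronglyMeasurable hS'c.measurableSet
  · refine (ae_restrict_mem hS'c.measurableSet).mono fun x hx t ht => ?_
    have htI : 1 + t ∈ Ioo (1 / 2 : ℝ) (3 / 2) := by
      rw [abs_lt] at ht; constructor <;> linarith
    have := (convex_Ioo (1 / 2 : ℝ) (3 / 2)).norm_image_sub_le_of_norm_hasDerivWithin_le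
      (f := fun σ : ℝ => g (σ • x)) (f' := fun s => G (s • x) * s⁻¹) (C := 2 * max B 0)
      (x := 1) (y := 1 + t)
      (fun s hs => (hder' x (hS'M hx) s (by linarith [hs.1])).hasDerivWithinAt)
      (fun s hs => by
        have hs0 : 0 < s := by linarith [hs.1]
        rw [norm_mul, norm_inv, Real.norm_eq_abs, Real.norm_of_nonneg hs0.le, mul_comm (2 : ℝ)]
        gcongr
        · exact hB' _ (hcone x (hS'M hx) s hs0)
        · rw [inv_le_comm₀ hs0 two_pos]; linarith [hs.1])
      (by norm_num) htI
    simpa using this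
  · refine (ae_restrict_mem hS'c.measurableSet).mono fun x hx => ?_
    have h1 : HasDerivAt (fun s : ℝ => g (s • x)) (G x) (1 + 0) := by
      rw [add_zero]; exact hder x (hS'M hx)
    have h2 : HasDerivAt (fun t : ℝ => 1 + t) 1 0 := (hasDerivAt_id (0 : ℝ)).const_add 1
    simpa using! HasDerivAt.scomp (0 : ℝ) h1 h2

/-- The tangential derivative of a `C¹` field along `M` is continuous. -/
theorem IsC2Hypersurface.continuousOn_fderivWithin_comp_tangentProj (hM : IsC2Hypersurface M)
    {X : E n → E n} (hX : ContDiffOn ℝ 1 X M) :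
    ContinuousOn (fun x => fderivWithin ℝ X M x ∘L tangentProj M x) M := by
  intro p hp
  -- Being $C^1$ provides a continuous local derivative $f'$. It agrees with `fderivWithin` only on
  -- tangent vectors, hence the composition with the projection.
  obtain ⟨u, hu, -, f', hf', hf'c⟩ := (contDiffWithinAt_succ_iff_hasFDerivWithinAt
    (n := 0) (by simp)).1 (by simpa using hX p hp)
  rw [insert_eq_of_mem hp] at hu
  have hev : ∀ᶠ x in 𝓝[M] p, u ∈ 𝓝[M] x := eventually_eventually_nhdsWithin.2 hu
  have heq : ∀ᶠ x in 𝓝[M] p, fderivWithin ℝ X M x ∘L tangentProj M x = f' x ∘L tangentProj M x := by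
    filter_upwards [hev, hu, self_mem_nhdsWithin] with x hx hxu hxM
    have h1 : HasFDerivWithinAt X (f' x) M x := (hf' x hxu).mono_of_mem_nhdsWithin hx
    ext1 v
    exact eqOn_tangentSpace h1.differentiableWithinAt.hasFDerivWithinAt h1
      (Submodule.starProjection_apply_mem _ v)
  have hc : ContinuousWithinAt f' M p :=
    hf'c.continuousWithinAt.mono_of_mem_nhdsWithin hu
  exact (hc.clm_comp (hM.continuousOn_tangentProj p hp)).congr_of_eventuallyEq heq
    (heq.self_of_nhdsWithin hp)

theorem frame_mem (x : E n) (i) : frame M x i ∈ tangentSpace M x :=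
  (stdOrthonormalBasis ℝ (tangentSpace M x) i).2

theorem sum_inner_frame_smul {x v : E n} (hv : v ∈ tangentSpace M x) :
    ∑ i, inner ℝ v (frame M x i) • frame M x i = v := by
  have := congrArg (tangentSpace M x).subtype
    ((stdOrthonormalBasis ℝ (tangentSpace M x)).sum_repr' ⟨v, hv⟩)
  rw [map_sum] at this
  refine Eq.trans (Finset.sum_congr rfl fun i _ => ?_) this
  rw [map_smul, real_inner_comm]
  rfl

theorem sum_inner_frame_sq (x v : E n) :
    ∑ i, inner ℝ v (frame M x i) ^ 2 = ‖tangentProj M x v‖ ^ 2 := by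
  have := (stdOrthonormalBasis ℝ (tangentSpace M x)).sum_sq_norm_inner_right
    ((tangentSpace M x).orthogonalProjectionOnto v)
  refine Eq.trans (Finset.sum_congr rfl fun i _ => ?_) this
  rw [Submodule.inner_orthogonalProjectionOnto_eq_of_mem_left, Real.norm_eq_abs, sq_abs, real_inner_comm]
  rfl

/-- The square norm of a linear map on the tangent space, in terms of the standard basis. -/
theorem sum_norm_frame_sq (x : E n) (L : E n →L[ℝ] E n) :
    ∑ i, ‖L (frame M x i)‖ ^ 2 =
      ∑ j, ‖L (tangentProj M x (EuclideanSpace.basisFun (Fin n) ℝ j))‖ ^ 2 := by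
  set b := EuclideanSpace.basisFun (Fin n) ℝ
  -- Passing to the adjoint turns both sides into $\sum_k|P L^\dagger b_k|^2$, free of the frame,
  -- which need not vary continuously.
  have h1 : ∀ v, ‖L v‖ ^ 2 = ∑ k, inner ℝ (ContinuousLinearMap.adjoint L (b k)) v ^ 2 := by
    intro v
    rw [← b.sum_sq_norm_inner_right]
    refine Finset.sum_congr rfl fun k _ => ?_
    rw [ContinuousLinearMap.adjoint_inner_left, Real.norm_eq_abs, sq_abs]
  simp only [h1]
  rw [Finset.sum_comm]
  conv_rhs => rw [Finset.sum_comm]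
  refine Finset.sum_congr rfl fun k _ => ?_
  rw [sum_inner_frame_sq, ← b.sum_sq_norm_inner_right]
  refine Finset.sum_congr rfl fun j _ => ?_
  rw [Real.norm_eq_abs, sq_abs, tangentProj, ← Submodule.inner_starProjection_left_eq_right,
    real_inner_comm]

end Radial

/-! ### Derivatives of $|x|^a$ and the second variation -/

section SecondVariation

variable {n : ℕ} {M U : Set (E n)} {X : E n → E n} {x : E n}

local notation "ℋ" => Measure.hausdorffMeasure ((n : ℝ) - 1)

theorem contDiffOn_norm_rpow (a : ℝ) :
    ContDiffOn ℝ 2 (fun x : E n => ‖x‖ ^ a) {0}ᶜ := fun _ hx =>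
  ((contDiffAt_norm ℝ hx).rpow_const_of_ne (norm_ne_zero_iff.2 hx)).contDiffWithinAt

theorem hasFDerivAt_norm_rpow_of_ne_zero (hx : x ≠ 0) (a : ℝ) :
    HasFDerivAt (fun x : E n => ‖x‖ ^ a) ((a * ‖x‖ ^ (a - 2)) • innerSL ℝ x) x := by
  have h1 : ‖x‖ ^ 2 ≠ 0 := by simpa using hx
  have h2 := (hasStrictFDerivAt_norm_sq x).hasFDerivAt.rpow_const (p := a / 2) (Or.inl h1)
  have h3 : (fun y : E n => (‖y‖ ^ 2) ^ (a / 2)) = fun y => ‖y‖ ^ a := by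
    funext y
    rw [← Real.rpow_natCast, ← Real.rpow_mul (norm_nonneg y)]
    congr 1
    push_cast
    ring
  rw [h3] at h2
  refine h2.congr_fderiv ?_
  rw [← Nat.cast_smul_eq_nsmul ℝ, smul_smul, ← Real.rpow_natCast, ← Real.rpow_mul (norm_nonneg x)]
  congr 1
  have : ((2 : ℕ) : ℝ) * (a / 2 - 1) = a - 2 := by push_cast; ring
  rw [this]
  push_cast
  ring

/-- The gradient is $a|y|^{a-2}y$; differentiating its coefficient produces a factor $\langle
x,v\rangle=0$. -/
theorem hess_norm_rpow (hx : x ≠ 0) (a : ℝ) {v : E n} (hv : inner ℝ x v = 0) :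
    hess (fun x => ‖x‖ ^ a) x v v = a * (‖x‖ ^ (a - 2) * ‖v‖ ^ 2) := by
  have h1 : fderiv ℝ (fun x : E n => ‖x‖ ^ a) =ᶠ[𝓝 x]
      fun y => (a * ‖y‖ ^ (a - 2)) • innerSL ℝ y := by
    filter_upwards [isOpen_ne.mem_nhds hx] with y hy
    exact (hasFDerivAt_norm_rpow_of_ne_zero hy a).fderiv
  have h2 : HasFDerivAt (fun y : E n => (a * ‖y‖ ^ (a - 2)) • innerSL ℝ y) _ x :=
    ((hasFDerivAt_norm_rpow_of_ne_zero hx (a - 2)).const_mul a).smul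
      (innerSL ℝ (E := E n)).hasFDerivAt
  rw [hess, h1.fderiv_eq, h2.fderiv]
  simp only [add_apply, smul_apply, ContinuousLinearMap.smulRight_apply, innerSL_apply_apply, hv,
    smul_eq_mul, mul_zero, add_zero, zero_smul]
  have h3 : innerSL ℝ v v = ‖v‖ ^ 2 := real_inner_self_eq_norm_sq v
  rw [mul_assoc]
  exact congrArg (fun r => a * (‖x‖ ^ (a - 2) * r)) h3

theorem norm_rpow_mul_sq (hx : x ≠ 0) (a : ℝ) : ‖x‖ ^ (a - 2) * ‖x‖ ^ 2 = ‖x‖ ^ a := by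
  rw [← Real.rpow_natCast, ← Real.rpow_add (norm_pos_iff.2 hx)]
  congr 1
  push_cast
  ring

theorem normalProj_of_mem {v : E n} (hv : v ∈ (tangentSpace M x)ᗮ) : normalProj M x v = v :=
  Submodule.starProjection_eq_self_iff.2 hv

theorem inner_normalProj_left {v w : E n} (hv : v ∈ (tangentSpace M x)ᗮ) :
    inner ℝ (normalProj M x w) v = inner ℝ w v := by
  rw [normalProj, Submodule.inner_starProjection_left_eq_right]
  exact congrArg _ (normalProj_of_mem hv)

/-- The rays of a cone are tangent to it. -/
theorem self_mem_tangentSpace (hcone : ∀ x ∈ M, ∀ t : ℝ, 0 < t → t • x ∈ M) (hx : x ∈ M) :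
    x ∈ tangentSpace M x := by
  have h : HasDerivAt (fun t : ℝ => (1 + t) • x) x 0 := by
    simpa using ((hasDerivAt_id (0 : ℝ)).const_add 1).smul_const x
  have := mem_tangentSpace_of_hasDerivAt (M := M) h (by
    filter_upwards [Ioi_mem_nhds (show (-1 : ℝ) < 0 by norm_num)] with t ht
    exact hcone x hx _ (by linarith [mem_Ioi.1 ht]))
  simpa using this

theorem hasDerivAt_comp_ray (hcone : ∀ x ∈ M, ∀ t : ℝ, 0 < t → t • x ∈ M) (hx : x ∈ M)
    {X' : E n →L[ℝ] E n} (hX : HasFDerivWithinAt X X' M x) :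
    HasDerivAt (fun s : ℝ => X (s • x)) (X' x) 1 := by
  have h1 : HasDerivAt (fun s : ℝ => s • x) x 1 := by
    simpa using (hasDerivAt_id (1 : ℝ)).smul_const x
  have h2 := hX.comp_hasDerivWithinAt_of_eq (1 : ℝ) (h1.hasDerivWithinAt (s := Ioi 0))
    (fun s hs => hcone x hx s hs) (one_smul ℝ x).symm
  exact h2.hasDerivAt (Ioi_mem_nhds one_pos)

/-- Product-rule expansion: the normal projection is self-adjoint and fixes $v$, so the cross terms
collect into one pairing with $\sum_i y_iD_i$. For $y_i=\langle x,e_i\rangle$ this sum is the radial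
derivative. -/
theorem sum_norm_normalProj_smul_add {ι : Type*} [Fintype ι] (c k : ℝ) (y : ι → ℝ)
    (D : ι → E n) {v : E n} (hv : v ∈ (tangentSpace M x)ᗮ) :
    ∑ i, ‖normalProj M x (c • D i + (k * y i) • v)‖ ^ 2 =
      c ^ 2 * ∑ i, ‖normalProj M x (D i)‖ ^ 2 + 2 * (c * k) * inner ℝ (∑ i, y i • D i) v +
        k ^ 2 * (∑ i, y i ^ 2) * ‖v‖ ^ 2 := by
  rw [sum_inner, Finset.mul_sum, Finset.mul_sum, Finset.mul_sum, Finset.sum_mul,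
    ← Finset.sum_add_distrib, ← Finset.sum_add_distrib]
  refine Finset.sum_congr rfl fun i _ => ?_
  rw [map_add, map_smul, map_smul, normalProj_of_mem hv, norm_add_sq_real, norm_smul, norm_smul,
    real_inner_smul_left, real_inner_smul_right, real_inner_smul_left, inner_normalProj_left hv,
    mul_pow, mul_pow, Real.norm_eq_abs, Real.norm_eq_abs, sq_abs, sq_abs]
  ring

/-- The gradient term of the second variation for the field `|x|^(a/2) X` on a cone. -/
theorem sum_norm_normalProj_rpow_smul (hcone : ∀ x ∈ M, ∀ t : ℝ, 0 < t → t • x ∈ M)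
    (hx : x ∈ M) (hx0 : x ≠ 0) (hX : DifferentiableWithinAt ℝ X M x)
    (hXn : X x ∈ (tangentSpace M x)ᗮ) (a : ℝ) :
    ∑ i, ‖normalProj M x (tangentialDeriv M (fun y => ‖y‖ ^ (a / 2) • X y) x (frame M x i))‖ ^ 2 =
      ‖x‖ ^ a * ∑ i, ‖normalProj M x (tangentialDeriv M X x (frame M x i))‖ ^ 2 +
        a * (‖x‖ ^ (a - 2) * inner ℝ (tangentialDeriv M X x x) (X x)) +
        a ^ 2 / 4 * (‖x‖ ^ (a - 2) * ‖X x‖ ^ 2) := by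
  have hxT := self_mem_tangentSpace hcone hx
  have hd : HasFDerivWithinAt (fun y => ‖y‖ ^ (a / 2) • X y) _ M x :=
    (hasFDerivAt_norm_rpow_of_ne_zero hx0 (a / 2)).hasFDerivWithinAt.smul hX.hasFDerivWithinAt
  have h1 : ∀ i, tangentialDeriv M (fun y => ‖y‖ ^ (a / 2) • X y) x (frame M x i) =
      ‖x‖ ^ (a / 2) • tangentialDeriv M X x (frame M x i) +
        ((a / 2 * ‖x‖ ^ (a / 2 - 2)) * inner ℝ x (frame M x i)) • X x := by
    intro i
    rw [tangentialDeriv_eq hd (frame_mem x i)]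
    simp [tangentialDeriv, innerSL_apply_apply]
  have h2 : ∑ i, inner ℝ x (frame M x i) • tangentialDeriv M X x (frame M x i) =
      tangentialDeriv M X x x := by
    have := congrArg (fderivWithin ℝ X M x) (sum_inner_frame_smul hxT)
    simp only [map_sum, map_smul] at this
    exact this
  have h3 : tangentProj M x x = x := Submodule.starProjection_eq_self_iff.2 hxT
  have hpos := norm_pos_iff.2 hx0
  have h4 : (‖x‖ ^ (a / 2)) ^ 2 = ‖x‖ ^ a := by
    rw [← Real.rpow_natCast, ← Real.rpow_mul hpos.le]; congr 1; push_cast; ring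
  have h5 : ‖x‖ ^ (a / 2) * ‖x‖ ^ (a / 2 - 2) = ‖x‖ ^ (a - 2) := by
    rw [← Real.rpow_add hpos]; congr 1; ring
  have h6 : (‖x‖ ^ (a / 2 - 2)) ^ 2 * ‖x‖ ^ 2 = ‖x‖ ^ (a - 2) := by
    rw [← Real.rpow_natCast, ← Real.rpow_natCast, ← Real.rpow_mul hpos.le, ← Real.rpow_add hpos]
    congr 1; push_cast; ring
  simp only [h1]
  rw [sum_norm_normalProj_smul_add _ _ _ _ hXn, h2, sum_inner_frame_sq, h3, h4, ← h5]
  have h7 : (a / 2 * ‖x‖ ^ (a / 2 - 2)) ^ 2 * ‖x‖ ^ 2 = a ^ 2 / 4 * ‖x‖ ^ (a - 2) := by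
    rw [← h6]; ring
  rw [h7, ← h5]
  ring

/-- On a cone, the second variation inequality for the area implies the one for the density
`|x|^a`. -/
theorem secondVariation_norm_rpow (hM : IsC2Hypersurface M)
    (hcone : ∀ x ∈ M, ∀ t : ℝ, 0 < t → t • x ∈ M) (h0 : (0 : E n) ∉ M)
    (hUM : U ∩ (closure M \ M) = ∅) (hstable : IsStable (fun _ => 1) M U) {a : ℝ} (ha : 0 ≤ a)
    (hX : IsNormalVariation M U X) :
    ∫ x in M, ‖x‖ ^ a * ((∑ i, ∑ j,
          (inner ℝ (secondFundamentalForm M x (frame M x i) (frame M x j)) (X x)) ^ 2)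
        + (inner ℝ (meanCurvature M x) (X x)) ^ 2) ∂ℋ
      ≤ ∫ x in M, (‖x‖ ^ a * (∑ i, ‖normalProj M x (tangentialDeriv M X x (frame M x i))‖ ^ 2)
        + hess (fun x => ‖x‖ ^ a) x (X x) (X x)) ∂ℋ := by
  rcases M.eq_empty_or_nonempty with rfl | ⟨p, hp⟩
  · simp
  have hn := hM.one_le_dim hp
  have hMm := hM.measurableSet
  have hne : ∀ x ∈ M, x ≠ 0 := fun x hx h => h0 (h ▸ hx)
  obtain ⟨K, hK, hKU, hXK⟩ := hX.compactSupport
  have hSc : IsCompact (M ∩ K) := by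
    have : M ∩ K = closure M ∩ K := by
      refine Subset.antisymm (inter_subset_inter_left _ subset_closure) fun x hx => ⟨?_, hx.2⟩
      by_contra hxM
      exact (hUM.subset ⟨hKU hx.2, hx.1, hxM⟩ : x ∈ (∅ : Set (E n)))
    rw [this]
    exact hK.inter_left isClosed_closure
  have hSM : M ∩ K ⊆ M := inter_subset_left
  have hX0 : ∀ x ∈ M, x ∉ M ∩ K → X x = 0 := fun x hx hxS => hXK x hx fun h => hxS ⟨hx, h⟩
  have hXd : ∀ x ∈ M, DifferentiableWithinAt ℝ X M x :=
    hX.contDiffOn.differentiableOn one_ne_zero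
  have hD0 : ∀ x ∈ M, x ∉ M ∩ K → ∀ v ∈ tangentSpace M x, tangentialDeriv M X x v = 0 := by
    intro x hx hxS v hv
    have h1 : HasFDerivWithinAt X (0 : E n →L[ℝ] E n) M x := by
      refine (hasFDerivWithinAt_const (0 : E n) x M).congr_of_eventuallyEq ?_ (hX0 x hx hxS)
      filter_upwards [self_mem_nhdsWithin,
        mem_nhdsWithin_of_mem_nhds (hSc.isClosed.isOpen_compl.mem_nhds hxS)] with y hy hyS
      exact hX0 y hy hyS
    rw [tangentialDeriv_eq h1 hv]
    rfl
  have hDc := hM.continuousOn_fderivWithin_comp_tangentProj hX.contDiffOn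
  have hrpow : ∀ b : ℝ, ContinuousOn (fun x : E n => ‖x‖ ^ b) M := fun b =>
    (contDiffOn_norm_rpow b).continuousOn.mono fun x hx => hne x hx
  have hXc : ContinuousOn X M := hX.contDiffOn.continuousOn
  -- Half the exponent, because the second variation is quadratic in the field.
  set Y : E n → E n := fun y => ‖y‖ ^ (a / 2) • X y with hY
  have hYvar : IsNormalVariation M U Y := by
    refine ⟨?_, fun x hx => Submodule.smul_mem _ _ (hX.normal x hx), K, hK, hKU, ?_⟩
    · exact (((contDiffOn_norm_rpow (a / 2)).mono fun x hx => hne x hx).of_le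
        (by norm_num)).smul hX.contDiffOn
    · intro x hx hxK
      simp [hY, hXK x hx hxK]
  set g : E n → ℝ := fun x => ‖x‖ ^ (a - 2) * ‖X x‖ ^ 2 with hg
  set R : E n → ℝ := fun x => ‖x‖ ^ (a - 2) * inner ℝ (tangentialDeriv M X x x) (X x) with hR
  -- The radial derivative of $g$; solving for $R$ writes $aR$ as $\frac a2G-\frac a2(a-2)g$.
  set G : E n → ℝ := fun x => (a - 2) * g x + 2 * R x with hG
  set Q : E n → ℝ := fun x =>
    ‖x‖ ^ a * ∑ i, ‖normalProj M x (tangentialDeriv M X x (frame M x i))‖ ^ 2 with hQ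
  have hgc : ContinuousOn g M := (hrpow _).mul (hXc.norm.pow 2)
  have hDx : ContinuousOn (fun x => tangentialDeriv M X x x) M := by
    refine (hDc.clm_apply continuousOn_id).congr fun x hx => ?_
    have : tangentProj M x x = x :=
      Submodule.starProjection_eq_self_iff.2 (self_mem_tangentSpace hcone hx)
    simp [this, tangentialDeriv]
  have hRc : ContinuousOn R M := (hrpow _).mul (hDx.inner hXc)
  have hGc : ContinuousOn G M := (continuousOn_const.mul hgc).add (continuousOn_const.mul hRc)
  have hQc : ContinuousOn Q M := by
    refine (hrpow a).mul ?_
    have h1 : ∀ x, ∑ i, ‖normalProj M x (tangentialDeriv M X x (frame M x i))‖ ^ 2 =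
        ∑ j, ‖normalProj M x ((fderivWithin ℝ X M x ∘L tangentProj M x)
          (EuclideanSpace.basisFun (Fin n) ℝ j))‖ ^ 2 := fun x =>
      sum_norm_frame_sq x (normalProj M x ∘L fderivWithin ℝ X M x)
    simp only [h1]
    refine continuousOn_finsetSum _ fun j _ => ContinuousOn.pow (ContinuousOn.norm ?_) 2
    exact hM.continuousOn_normalProj.clm_apply (hDc.clm_apply continuousOn_const)
  have hg0 : ∀ x ∈ M, x ∉ M ∩ K → g x = 0 := fun x hx hxS => by simp [hg, hX0 x hx hxS]
  have hR0 : ∀ x ∈ M, x ∉ M ∩ K → R x = 0 := fun x hx hxS => by simp [hR, hX0 x hx hxS]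
  have hQ0 : ∀ x ∈ M, x ∉ M ∩ K → Q x = 0 := fun x hx hxS => by
    simp [hQ, hD0 x hx hxS _ (frame_mem x _)]
  have hint : ∀ {q : E n → ℝ}, ContinuousOn q M → (∀ x ∈ M, x ∉ M ∩ K → q x = 0) →
      IntegrableOn q M ℋ := fun hq hq0 =>
    (hM.integrableOn hSc hSM (hq.mono hSM)).of_forall_sdiff_eq_zero hMm
      fun x hx => hq0 x hx.1 hx.2
  have hgi := hint hgc hg0
  have hGi := hint hGc fun x hx hxS => by simp [hG, hg0 x hx hxS, hR0 x hx hxS]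
  have hQi := hint hQc hQ0
  have hrad : ∫ x in M, G x ∂ℋ = -((n : ℝ) - 1) * ∫ x in M, g x ∂ℋ := by
    refine hM.integral_radial_deriv hcone hSc hSM hgc hGc hg0
      (fun x hx hxS => by simp [hG, hg0 x hx hxS, hR0 x hx hxS]) fun x hx => ?_
    have h1 := hasDerivAt_comp_ray hcone hx (hXd x hx).hasFDerivWithinAt
    have h2 : HasDerivAt (fun s : ℝ => ‖s • x‖ ^ (a - 2)) ((a - 2) * ‖x‖ ^ (a - 2)) 1 := by
      have h3 : HasDerivAt (fun s : ℝ => s • x) x 1 := by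
        simpa using (hasDerivAt_id (1 : ℝ)).smul_const x
      have h4 := (hasFDerivAt_norm_rpow_of_ne_zero (hne x hx) (a - 2)).comp_hasDerivAt_of_eq
        (1 : ℝ) h3 (one_smul ℝ x).symm
      refine h4.congr_deriv ?_
      rw [smul_apply, innerSL_apply_apply, real_inner_self_eq_norm_sq, smul_eq_mul, mul_assoc,
        norm_rpow_mul_sq (hne x hx)]
    refine (h2.mul h1.norm_sq).congr_deriv ?_
    simp only [one_smul, hG, hg, hR, tangentialDeriv, real_inner_comm]
    ring
  have hsec := hstable.secondVariation Y hYvar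
  have hleft : ∫ x in M, ‖x‖ ^ a * ((∑ i, ∑ j,
          (inner ℝ (secondFundamentalForm M x (frame M x i) (frame M x j)) (X x)) ^ 2)
        + (inner ℝ (meanCurvature M x) (X x)) ^ 2) ∂ℋ = ∫ x in M, 1 * ((∑ i, ∑ j,
          (inner ℝ (secondFundamentalForm M x (frame M x i) (frame M x j)) (Y x)) ^ 2)
        + (inner ℝ (meanCurvature M x) (Y x)) ^ 2) ∂ℋ := by
    refine setIntegral_congr_fun hMm fun x hx => ?_
    have h1 : (‖x‖ ^ (a / 2)) ^ 2 = ‖x‖ ^ a := by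
      rw [← Real.rpow_natCast, ← Real.rpow_mul (norm_nonneg x)]; congr 1; push_cast; ring
    simp only [hY, real_inner_smul_right, mul_pow, h1, ← Finset.mul_sum, one_mul]
    ring
  have hright : ∫ x in M, (1 * (∑ i, ‖normalProj M x (tangentialDeriv M Y x (frame M x i))‖ ^ 2)
        + hess (fun _ => 1) x (Y x) (Y x)) ∂ℋ =
      ∫ x in M, (Q x + a / 2 * G x + (a ^ 2 / 4 - a / 2 * (a - 2)) * g x) ∂ℋ := by
    refine setIntegral_congr_fun hMm fun x hx => ?_
    have h1 : ∀ v, hess (fun _ : E n => (1 : ℝ)) x v v = 0 := fun v => by simp [hess]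
    simp only [h1, add_zero, one_mul, hY]
    rw [sum_norm_normalProj_rpow_smul hcone hx (hne x hx) (hXd x hx) (hX.normal x hx)]
    simp only [hQ, hG, hR, hg]
    ring
  have hright' : ∫ x in M, (‖x‖ ^ a *
        (∑ i, ‖normalProj M x (tangentialDeriv M X x (frame M x i))‖ ^ 2)
        + hess (fun x => ‖x‖ ^ a) x (X x) (X x)) ∂ℋ = ∫ x in M, (Q x + a * g x) ∂ℋ := by
    refine setIntegral_congr_fun hMm fun x hx => ?_
    simp only [hQ, hg]
    rw [hess_norm_rpow (hne x hx) a
      ((Submodule.mem_orthogonal _ _).1 (hX.normal x hx) x (self_mem_tangentSpace hcone hx))]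
  rw [hleft, hright']
  refine hsec.trans ?_
  have hQG : IntegrableOn (fun x => Q x + a / 2 * G x) M ℋ := hQi.add (hGi.const_mul _)
  rw [hright, integral_add hQG (hgi.const_mul _),
    integral_add hQi (hGi.const_mul _), integral_add hQi (hgi.const_mul _), integral_const_mul,
    integral_const_mul, integral_const_mul, hrad]
  have hg_nonneg : 0 ≤ ∫ x in M, g x ∂ℋ := integral_nonneg fun x => by positivity
  -- The gap between the two sides is $(\frac{a(n-1)}2+\frac{a^2}4)\int g$.
  nlinarith [mul_nonneg (mul_nonneg ha hn) hg_nonneg, mul_nonneg (mul_nonneg ha ha) hg_nonneg]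

end SecondVariation

end WeightedArea

/-! ### The corollary -/

theorem corollary1p9 (n : ℕ) (Γ : Set (WeightedArea.E n)) (hΓ : Γ ⊆ Metric.sphere 0 1)
    (M : Set (WeightedArea.E n)) (hM : M = WeightedArea.cone Γ \ {0})
    (hM2 : WeightedArea.IsC2Hypersurface M) (hMo : WeightedArea.IsOrientable M)
    (U : Set (WeightedArea.E n)) (hU : IsOpen U) (hUM : U ∩ (closure M \ M) = ∅)
    (hstable : WeightedArea.IsStable (fun _ => 1) M U)
    (α : ℝ) (hα : 0 ≤ α) :
    WeightedArea.IsStable (fun x => ‖x‖ ^ α) M U := by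
  have h0 : (0 : WeightedArea.E n) ∉ M := by rw [hM]; exact fun h => h.2 rfl
  have hcone : ∀ x ∈ M, ∀ t : ℝ, 0 < t → t • x ∈ M := by
    rw [hM]
    rintro _ ⟨⟨s, hs, y, hy, rfl⟩, hne⟩ t ht
    refine ⟨⟨t * s, by positivity, y, hy, smul_smul t s y⟩, ?_⟩
    exact smul_ne_zero ht.ne' hne
  refine ⟨?_, fun X hX =>
    WeightedArea.secondVariation_norm_rpow hM2 hcone h0 hUM hstable hα hX⟩
  -- For empty $M$ the origin may lie in $U$, where the density need not be $C^2$, so this case is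
  -- separate.
  rcases M.eq_empty_or_nonempty with rfl | ⟨p, hp⟩
  · intro K ε φ _
    simpa [WeightedArea.weightedArea] using hasDerivAt_const (0 : ℝ) (0 : ℝ)
  have h0U : (0 : WeightedArea.E n) ∉ U := by
    intro h
    have hcl : (0 : WeightedArea.E n) ∈ closure M := by
      have ht : Filter.Tendsto (fun t : ℝ => t • p) (nhdsWithin 0 (Set.Ioi 0))
          (nhds ((0 : ℝ) • p)) :=
        ((continuous_id.smul continuous_const).tendsto 0).mono_left nhdsWithin_le_nhds
      rw [zero_smul] at ht
      refine mem_closure_of_tendsto ht ?_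
      filter_upwards [self_mem_nhdsWithin] with t ht using hcone p hp t ht
    exact (hUM.subset ⟨h, hcl, h0⟩ : (0 : WeightedArea.E n) ∈ (∅ : Set _))
  refine WeightedArea.IsStationary.of_gradient_tangent hM2 hUM hstable.stationary
    (O := {0}ᶜ) isOpen_compl_singleton
    (fun x hx (hx0 : x = 0) => h0U (hx0 ▸ hx))
    (WeightedArea.contDiffOn_norm_rpow α) fun x hx w => ?_
  have hx0 : x ≠ 0 := fun h => h0 (h ▸ hx)
  have hperp : inner ℝ x (WeightedArea.normalProj M x w) = 0 :=
    (Submodule.mem_orthogonal _ _).1 (Submodule.starProjection_apply_mem _ w) x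
      (WeightedArea.self_mem_tangentSpace hcone hx)
  rw [(WeightedArea.hasFDerivAt_norm_rpow_of_ne_zero hx0 α).fderiv, smul_apply,
    innerSL_apply_apply, hperp, smul_zero]
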